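/- All graphs are finite and simple. Let $G$ be a connected graph with vertex set $V$, $|V|=n\ge 1$. Let $X=\{x_v : v\in V\}$ be indeterminates, let $D(G)=(d_G(u,v))_{u,v\in V}$ be the distance matrix of $G$ and $D_X(G)=\operatorname{diag}(X)+D(G)$. For $1\le i\le n$ the $i$-th distance ideal $I_i^{\mathbb Z}(G)\subseteq\mathbb Z[X]$ is the ideal generated by all $i\times i$ minors of $D_X(G)$; it is trivial if $I_i^{\mathbb Z}(G)=\mathbb Z[X]$. Let $\Lambda_2^{\mathbb Z}$ be the family of connected graphs having at most two trivial distance ideals over $\mathbb Z[X]$. For $\mathbf a\in\mathbb Z^k$ let $P_k^{\mathbf a}$ be the graph obtained from the path $P_k$ by replacing its $i$-th vertex by a clique of size $a_i+1$ if $a_i>0$, by an independent set of size $-a_i+1$ if $a_i<0$, and keeping it if $a_i=0$, where all edges are present between the sets that replace two adjacent vertices of $P_k$ and none between the sets that replace two distinct non-adjacent vertices. Let $\mathcal F$ be the set of the following sixteen graphs, where $ij$ denotes an edge between $i$ and $j$. On the vertices $0,\dots,4$: bull $\{04,13,23,24,34\}$; dart $\{04,13,14,23,24,34\}$; house $\{01,04,13,23,24,34\}$;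 gem $\{03,04,12,14,23,24,34\}$; full-house $\{03,04,12,13,14,23,24,34\}$. On the vertices $0,\dots,5$: $G_{6,5}$ $\{04,15,23,25,35,45\}$; 5-pan $\{05,12,14,23,35,45\}$; $G_{6,7}$ $\{04,12,15,25,34,35\}$; $G_{6,8}$ $\{05,14,15,23,25,35,45\}$; $G_{6,9}$ $\{05,15,23,24,34,35,45\}$; $G_{6,10}$ $\{01,05,14,24,25,34,35\}$; co-twin-house $\{05,14,23,24,25,34,35\}$; $G_{6,12}$ $\{05,14,15,23,24,25,34,35\}$; co-twin-$C_5$ $\{01,05,14,23,24,25,34,35\}$; $G_{6,14}=K_{2,2,1,1}$ $\{02,03,04,05,12,13,14,15,24,25,34,35,45\}$. On the vertices $0,\dots,6$: $G_{6,15}$ $\{01,06,16,24,25,34,35,46,56\}$. Let $\textsf{odd-holes}_7$ be the set of cycles of odd length at least $7$. A graph is $\{\mathcal F,\textsf{odd-holes}_7\}$-free if none of its induced subgraphs is isomorphic to a member of $\mathcal F\cup\textsf{odd-holes}_7$. **Theorem.** Let $G$ be a connected graph with $n\ge 1$ vertices. (a) $G\in\Lambda_2^{\mathbb Z}$ if and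 only if, up to isomorphism, $G$ is one of the following: (i) the cycle $C_5$; (ii) a bipartite graph; (iii) a complete tripartite graph (with three nonempty parts); (iv) $K_{n-p+1,1,\dots,1}$, the complete multipartite graph on $n$ vertices with $p$ parts, at most one of which is not a singleton, for some $1\le p\le n$; (v) an induced subgraph of $P_5^{(-m_1,n_1,-m_2,n_2,-m_3)}$ for some integers $m_1,n_1,m_2,n_2,m_3\ge 0$; (vi) an induced subgraph of $P_4^{(n_1,-m_1,-m_2,n_2)}$ for some integers $n_1,m_1,m_2,n_2\ge 0$. (b) $G\in\Lambda_2^{\mathbb Z}$ if and only if $G$ is $\{\mathcal F,\textsf{odd-holes}_7\}$-free. -/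

import Mathlib

/-- The generalized distance matrix `diag(X) + D(G)`, with entries in the polynomial ring over `R`
in one variable for each vertex. -/
noncomputable def genDistMatrix (R : Type*) [CommRing R] {V : Type*} [DecidableEq V]
    (G : SimpleGraph V) : Matrix V V (MvPolynomial V R) :=
  Matrix.diagonal (fun v => MvPolynomial.X v) +
    Matrix.of (fun u v => ((G.dist u v : ℕ) : MvPolynomial V R))

/-- The `i`-th distance ideal: the ideal generated by the `i × i` minors of the generalized
distance matrix. The rows and the columns of a submatrix are selected by injections, so every minor
occurs up to sign, once for each ordering of the selected rows and columns. -/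
noncomputable def distanceIdeal (R : Type*) [CommRing R] {V : Type*} [DecidableEq V]
    (G : SimpleGraph V) (i : ℕ) : Ideal (MvPolynomial V R) :=
  Ideal.span {m | ∃ r c : Fin i ↪ V, m = ((genDistMatrix R G).submatrix r c).det}

/-- The number of indices `i` with `1 ≤ i ≤ n`, `n` the number of vertices, for which the `i`-th
distance ideal is trivial, that is, equal to the whole polynomial ring. -/
noncomputable def numTrivialDistanceIdeals (R : Type*) [CommRing R] {V : Type*} [Fintype V]
    [DecidableEq V] (G : SimpleGraph V) : ℕ :=
  {i : ℕ | 1 ≤ i ∧ i ≤ Fintype.card V ∧ distanceIdeal R G i = ⊤}.ncard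

/-- Membership in the family of connected graphs with at most `k` trivial distance ideals
over `R[X]`. -/
def MemLambda (R : Type*) [CommRing R] (k : ℕ) {V : Type*} [Fintype V] [DecidableEq V]
    (G : SimpleGraph V) : Prop :=
  G.Connected ∧ numTrivialDistanceIdeals R G ≤ k

/-- A graph is free of a family of graphs if no induced subgraph of it is isomorphic to a member. -/
def IsFamilyFree (𝓗 : Set (Σ n : ℕ, SimpleGraph (Fin n))) {V : Type*} (G : SimpleGraph V) : Prop :=
  ∀ H ∈ 𝓗, ¬ H.2.IsIndContained G

/-- The graph obtained from the path on `k` vertices by replacing the `i`-th vertex by a clique of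
size `a i + 1` if `a i > 0`, and by an independent set of size `-a i + 1` if `a i < 0`, keeping it
if `a i = 0`; vertices in the sets of two adjacent path vertices are adjacent. -/
def pathBlowup {k : ℕ} (a : Fin k → ℤ) :
    SimpleGraph (Σ i : Fin k, Fin ((a i).natAbs + 1)) where
  Adj x y := (SimpleGraph.pathGraph k).Adj x.1 y.1 ∨ (x.1 = y.1 ∧ x ≠ y ∧ 0 < a x.1)
  symm := ⟨by
    rintro x y (h | ⟨h, hne, hpos⟩)
    · exact Or.inl h.symm
    · exact Or.inr ⟨h.symm, hne.symm, h ▸ hpos⟩⟩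
  loopless := ⟨by
    rintro x (h | ⟨-, hne, -⟩)
    · exact h.ne rfl
    · exact hne rfl⟩

namespace ForbiddenGraph

def bull : SimpleGraph (Fin 5) :=
  .fromEdgeSet {s(0, 4), s(1, 3), s(2, 3), s(2, 4), s(3, 4)}

def dart : SimpleGraph (Fin 5) :=
  .fromEdgeSet {s(0, 4), s(1, 3), s(1, 4), s(2, 3), s(2, 4), s(3, 4)}

def house : SimpleGraph (Fin 5) :=
  .fromEdgeSet {s(0, 1), s(0, 4), s(1, 3), s(2, 3), s(2, 4), s(3, 4)}

def gem : SimpleGraph (Fin 5) :=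
  .fromEdgeSet {s(0, 3), s(0, 4), s(1, 2), s(1, 4), s(2, 3), s(2, 4), s(3, 4)}

def fullHouse : SimpleGraph (Fin 5) :=
  .fromEdgeSet {s(0, 3), s(0, 4), s(1, 2), s(1, 3), s(1, 4), s(2, 3), s(2, 4), s(3, 4)}

def G65 : SimpleGraph (Fin 6) :=
  .fromEdgeSet {s(0, 4), s(1, 5), s(2, 3), s(2, 5), s(3, 5), s(4, 5)}

def fivePan : SimpleGraph (Fin 6) :=
  .fromEdgeSet {s(0, 5), s(1, 2), s(1, 4), s(2, 3), s(3, 5), s(4, 5)}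

def G67 : SimpleGraph (Fin 6) :=
  .fromEdgeSet {s(0, 4), s(1, 2), s(1, 5), s(2, 5), s(3, 4), s(3, 5)}

def G68 : SimpleGraph (Fin 6) :=
  .fromEdgeSet {s(0, 5), s(1, 4), s(1, 5), s(2, 3), s(2, 5), s(3, 5), s(4, 5)}

def G69 : SimpleGraph (Fin 6) :=
  .fromEdgeSet {s(0, 5), s(1, 5), s(2, 3), s(2, 4), s(3, 4), s(3, 5), s(4, 5)}

def G610 : SimpleGraph (Fin 6) :=
  .fromEdgeSet {s(0, 1), s(0, 5), s(1, 4), s(2, 4), s(2, 5), s(3, 4), s(3, 5)}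

def coTwinHouse : SimpleGraph (Fin 6) :=
  .fromEdgeSet {s(0, 5), s(1, 4), s(2, 3), s(2, 4), s(2, 5), s(3, 4), s(3, 5)}

def G612 : SimpleGraph (Fin 6) :=
  .fromEdgeSet {s(0, 5), s(1, 4), s(1, 5), s(2, 3), s(2, 4), s(2, 5), s(3, 4), s(3, 5)}

def coTwinC5 : SimpleGraph (Fin 6) :=
  .fromEdgeSet {s(0, 1), s(0, 5), s(1, 4), s(2, 3), s(2, 4), s(2, 5), s(3, 4), s(3, 5)}

def G614 : SimpleGraph (Fin 6) :=
  .fromEdgeSet {s(0, 2), s(0, 3), s(0, 4), s(0, 5), s(1, 2), s(1, 3), s(1, 4), s(1, 5),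
    s(2, 4), s(2, 5), s(3, 4), s(3, 5), s(4, 5)}

def G615 : SimpleGraph (Fin 7) :=
  .fromEdgeSet {s(0, 1), s(0, 6), s(1, 6), s(2, 4), s(2, 5), s(3, 4), s(3, 5), s(4, 6), s(5, 6)}

/-- The family `𝓕` of sixteen graphs. -/
def family : Set (Σ n : ℕ, SimpleGraph (Fin n)) :=
  {⟨5, bull⟩, ⟨5, dart⟩, ⟨5, house⟩, ⟨5, gem⟩, ⟨5, fullHouse⟩, ⟨6, G65⟩, ⟨6, fivePan⟩, ⟨6, G67⟩,
    ⟨6, G68⟩, ⟨6, G69⟩, ⟨6, G610⟩, ⟨6, coTwinHouse⟩, ⟨6, G612⟩, ⟨6, coTwinC5⟩, ⟨6, G614⟩,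
    ⟨7, G615⟩}

/-- The cycles of odd length at least seven. -/
def oddHoles7 : Set (Σ n : ℕ, SimpleGraph (Fin n)) :=
  {H | ∃ k : ℕ, 7 ≤ k ∧ Odd k ∧ H = ⟨k, SimpleGraph.cycleGraph k⟩}

end ForbiddenGraph

/-- The complete tripartite graphs, with three nonempty parts. -/
def IsCompleteTripartite {V : Type*} (G : SimpleGraph V) : Prop :=
  ∃ a b c : ℕ, 0 < a ∧ 0 < b ∧ 0 < c ∧
    Nonempty (G ≃g SimpleGraph.completeMultipartiteGraph (fun i : Fin 3 => Fin (![a, b, c] i)))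

/-- `G` is `K_{n-p+1,1,…,1}` for some `1 ≤ p ≤ n`: the complete multipartite graph with `n` vertices
and `p` parts, all of which but the first are singletons. -/
def IsCompleteMultipartiteOneLarge {V : Type*} [Fintype V] (G : SimpleGraph V) : Prop :=
  ∃ p : ℕ, 1 ≤ p ∧ p ≤ Fintype.card V ∧
    Nonempty (G ≃g SimpleGraph.completeMultipartiteGraph
      (fun i : Fin p => Fin (if i.val = 0 then Fintype.card V - p + 1 else 1)))

-- Expansion along a row shows that the distance ideals decrease, so at most two of them are trivial
-- exactly when the third is proper. The third ideal is proper exactly when, over some field, the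
-- diagonal of the distance matrix can be filled in so that all `3 × 3` minors vanish: one direction
-- passes to the residue field at a maximal ideal, the other evaluates the variables. Both parts of
-- the theorem then follow from a cycle of implications: proper third ideal, forbidden-subgraph
-- freeness, membership in the list, proper third ideal.
--
-- From a rank two completion to freeness: distances in `G` between vertices of an induced subgraph
-- take few values, and for each choice some minors are either a unit whatever the diagonal is, or
-- integers without common divisor. `G67` and the co-twin-house need exact ambient distances,
-- obtained by excluding short connecting paths; this uses the absence of an induced 7-cycle, which
-- is therefore ruled out beforehand. For long odd holes, six consecutive vertices force
-- characteristic 2, and there rows two steps apart on the cycle coincide; odd length then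
-- identifies rows of consecutive vertices, which is absurd.
--
-- From freeness to the list: a non-bipartite graph contains an induced odd cycle, here of length 3
-- or 5. A 5-cycle cannot be extended (`no_cycle_five_extension`). Given a triangle, either some
-- 4-wheel exists and spreads to a complete tripartite graph (`IsFourWheel.isCompleteTripartite`),
-- or two vertices have equal closed neighborhoods (`exists_isTwin_of_triangle`). In the latter case
-- the layers around a twin class are each a clique or independent and are almost completely joined
-- (`IsTwin.exists_twinLayers`), which gives a multipartite graph or a path blowup.
--
-- From the list to a proper ideal: each listed graph has an explicit distance matrix of rank two
-- over `ZMod 2`, `ZMod 3` or `ZMod 11` (`distanceIdeal_ne_top_of_blocks`).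

universe u

open SimpleGraph ForbiddenGraph

/-! ### The decreasing chain of distance ideals. -/

section MinorIdeals

variable {V : Type u} [DecidableEq V]

theorem distanceIdeal_succ_le (R : Type*) [CommRing R] (G : SimpleGraph V) (i : ℕ) :
    distanceIdeal R G (i + 1) ≤ distanceIdeal R G i := by
  refine Ideal.span_le.2 ?_
  rintro m ⟨r, c, rfl⟩
  rw [SetLike.mem_coe, Matrix.det_succ_row_zero]
  refine Ideal.sum_mem _ fun j _ => Ideal.mul_mem_left _ _ (Ideal.subset_span ?_)
  exact ⟨(Fin.succEmb i).trans r, (Fin.succAboveEmb j).trans c, rfl⟩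

theorem distanceIdeal_antitone (R : Type*) [CommRing R] (G : SimpleGraph V) :
    Antitone (distanceIdeal R G) :=
  antitone_nat_of_succ_le (distanceIdeal_succ_le R G)

/-- Beyond the number of vertices there are no injections to select rows, so the ideal is zero. -/
theorem card_ge_of_distanceIdeal_eq_top [Fintype V] {R : Type*} [CommRing R] [Nontrivial R]
    {G : SimpleGraph V} {i : ℕ} (h : distanceIdeal R G i = ⊤) : i ≤ Fintype.card V := by
  by_contra hi
  have hempty : {m | ∃ r c : Fin i ↪ V, m = ((genDistMatrix R G).submatrix r c).det} = ∅ := by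
    refine Set.eq_empty_of_forall_notMem ?_
    rintro m ⟨r, -, -⟩
    exact hi (by simpa using Fintype.card_le_of_embedding r)
  rw [distanceIdeal, hempty, Ideal.span_empty] at h
  exact bot_ne_top h

/-- By antitonicity the indices of trivial ideals form an initial segment, so counting them amounts
to testing one ideal. -/
theorem memLambda_iff_distanceIdeal_ne_top [Fintype V] {R : Type*} [CommRing R] [Nontrivial R]
    {G : SimpleGraph V} (hG : G.Connected) (k : ℕ) :
    MemLambda R k G ↔ distanceIdeal R G (k + 1) ≠ ⊤ := by
  rw [MemLambda, and_iff_right hG, numTrivialDistanceIdeals]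
  constructor
  · intro h htop
    have hsub : Set.Icc 1 (k + 1) ⊆
        {i : ℕ | 1 ≤ i ∧ i ≤ Fintype.card V ∧ distanceIdeal R G i = ⊤} := by
      rintro i ⟨h1, h2⟩
      have : distanceIdeal R G i = ⊤ := top_le_iff.1 (htop ▸ distanceIdeal_antitone R G h2)
      exact ⟨h1, card_ge_of_distanceIdeal_eq_top this, this⟩
    have hfin : {i : ℕ | 1 ≤ i ∧ i ≤ Fintype.card V ∧ distanceIdeal R G i = ⊤}.Finite :=
      (Set.finite_Icc 1 (Fintype.card V)).subset fun i hi => ⟨hi.1, hi.2.1⟩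
    have := Set.ncard_le_ncard hsub hfin
    rw [← Finset.coe_Icc, Set.ncard_coe_finset, Nat.card_Icc] at this
    omega
  · intro h
    have hsub : {i : ℕ | 1 ≤ i ∧ i ≤ Fintype.card V ∧ distanceIdeal R G i = ⊤} ⊆
        Set.Icc 1 k := by
      rintro i ⟨h1, -, h3⟩
      refine ⟨h1, not_lt.1 fun hk => h (top_le_iff.1 (h3 ▸ distanceIdeal_antitone R G hk))⟩
    have := Set.ncard_le_ncard hsub (Set.finite_Icc 1 k)
    rw [← Finset.coe_Icc, Set.ncard_coe_finset, Nat.card_Icc] at this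
    omega

end MinorIdeals

/-! ### Proper third distance ideals and rank two completions over a field. -/

/-- The `3 × 3` minor of `M` with rows `a, b, c` and columns `d, e, f`. -/
def minor3 {R V : Type*} [CommRing R] (M : V → V → R) (a b c d e f : V) : R :=
  M a d * M b e * M c f - M a d * M b f * M c e - M a e * M b d * M c f + M a e * M b f * M c d +
    M a f * M b d * M c e - M a f * M b e * M c d

theorem minor3_eq_zero_of_eq_row {R V : Type*} [CommRing R] (M : V → V → R) {a b c : V} (d e f : V)
    (h : a = b ∨ a = c ∨ b = c) : minor3 M a b c d e f = 0 := by
  rcases h with rfl | rfl | rfl <;> · unfold minor3; ring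

theorem minor3_eq_zero_of_eq_col {R V : Type*} [CommRing R] (M : V → V → R) (a b c : V) {d e f : V}
    (h : d = e ∨ d = f ∨ e = f) : minor3 M a b c d e f = 0 := by
  rcases h with rfl | rfl | rfl <;> · unfold minor3; ring

/-- `M` agrees with the distance matrix of `G` off the diagonal, and its `3 × 3` minors vanish. -/
structure IsRankTwoCompletion {V K : Type*} [CommRing K] (G : SimpleGraph V) (M : V → V → K) :
    Prop where
  eq_dist : ∀ u v, u ≠ v → M u v = (G.dist u v : K)
  minor_eq_zero : ∀ a b c d e f, minor3 M a b c d e f = 0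

/-- The field is the residue field at a maximal ideal containing the third distance ideal, and the
diagonal consists of the classes of the variables. -/
theorem exists_isRankTwoCompletion {V : Type u} [DecidableEq V] {G : SimpleGraph V}
    (h : distanceIdeal ℤ G 3 ≠ ⊤) :
    ∃ (K : Type u) (_ : Field K) (M : V → V → K), IsRankTwoCompletion G M := by
  obtain ⟨I, hI, hle⟩ := Ideal.exists_le_maximal _ h
  let q := Ideal.Quotient.mk I
  refine ⟨MvPolynomial V ℤ ⧸ I, Ideal.Quotient.field I, fun u v => q (genDistMatrix ℤ G u v),
    ?_, ?_⟩
  · intro u v huv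
    simp [genDistMatrix, Matrix.diagonal_apply_ne _ huv]
  · intro a b c d e f
    by_cases hr : a = b ∨ a = c ∨ b = c
    · exact minor3_eq_zero_of_eq_row _ _ _ _ hr
    by_cases hc : d = e ∨ d = f ∨ e = f
    · exact minor3_eq_zero_of_eq_col _ _ _ _ hc
    have inj : ∀ {x y z : V}, ¬ (x = y ∨ x = z ∨ y = z) → Function.Injective ![x, y, z] := by
      intro x y z hxyz i j hij
      fin_cases i <;> fin_cases j <;> simp_all
    have hmem : ((genDistMatrix ℤ G).submatrix ![a, b, c] ![d, e, f]).det ∈ I :=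
      hle (Ideal.subset_span ⟨⟨_, inj hr⟩, ⟨_, inj hc⟩, rfl⟩)
    rw [← Ideal.Quotient.eq_zero_iff_mem, Matrix.det_fin_three] at hmem
    simpa [minor3, q] using hmem

/-- Evaluating the variables at `x` turns the matrix into a product through a space of dimension
`k`. All minors of size `k + 1` are then killed, so the ideal lies in the kernel of a ring
homomorphism to a field. -/
theorem distanceIdeal_ne_top_of_factorization {V K : Type*} [DecidableEq V] [Field K]
    {G : SimpleGraph V} {k : ℕ} (x : V → K) (P : V → Fin k → K) (Q : Fin k → V → K)
    (h : ∀ u v, (if u = v then x u else (G.dist u v : K)) = ∑ i, P u i * Q i v) :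
    distanceIdeal ℤ G (k + 1) ≠ ⊤ := by
  let φ : MvPolynomial V ℤ →+* K := MvPolynomial.eval₂Hom (Int.castRingHom K) x
  have hφ : ∀ u v, φ (genDistMatrix ℤ G u v) = ∑ i, P u i * Q i v := by
    intro u v
    rw [← h]
    split_ifs with huv
    · subst huv; simp [genDistMatrix, φ]
    · simp [genDistMatrix, Matrix.diagonal_apply_ne _ huv, φ]
  have hle : distanceIdeal ℤ G (k + 1) ≤ RingHom.ker φ := by
    refine Ideal.span_le.2 ?_
    rintro m ⟨r, c, rfl⟩
    rw [SetLike.mem_coe, RingHom.mem_ker, RingHom.map_det]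
    by_contra hdet
    have hmul : φ.mapMatrix ((genDistMatrix ℤ G).submatrix r c) =
        Matrix.of (fun i j => P (r i) j) * Matrix.of (fun i j => Q i (c j)) := by
      ext i j
      simp [Matrix.mul_apply, hφ]
    have hrank := Matrix.rank_of_isUnit _ ((Matrix.isUnit_iff_isUnit_det _).2 (Ne.isUnit hdet))
    rw [hmul] at hrank
    have := (Matrix.rank_mul_le_left (Matrix.of (fun i j => P (r i) j))
      (Matrix.of (fun i j => Q i (c j)))).trans (Matrix.rank_le_width _)
    rw [hrank, Fintype.card_fin] at this
    omega
  exact fun htop => RingHom.ker_ne_top φ (top_le_iff.1 (htop ▸ hle))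

/-! ### Small forbidden graphs excluded by their minors. -/

namespace IsRankTwoCompletion

variable {V K : Type*} [Field K] {G : SimpleGraph V} {M : V → V → K}
  {n : ℕ} {H : SimpleGraph (Fin n)}

/-- An induced embedding preserves adjacency but not distance. Distances one and two survive; a path
of three edges between nonadjacent vertices leaves two possible values, which later have to be
treated separately. -/
theorem dist_map_eq_one (f : H ↪g G) {i j : Fin n} (h : H.Adj i j) : G.dist (f i) (f j) = 1 :=
  dist_eq_one_iff_adj.2 (f.map_adj_iff.2 h)

theorem dist_map_ge_two (hG : G.Connected) (f : H ↪g G) {i j : Fin n} (hne : i ≠ j)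
    (h : ¬ H.Adj i j) : 2 ≤ G.dist (f i) (f j) := by
  have h0 : G.dist (f i) (f j) ≠ 0 := fun h0 =>
    hne (f.injective ((hG.dist_eq_zero_iff).1 h0))
  have h1 : G.dist (f i) (f j) ≠ 1 := fun h1 => h (f.map_adj_iff.1 (dist_eq_one_iff_adj.1 h1))
  omega

theorem dist_map_eq_two (hG : G.Connected) (f : H ↪g G) {i j : Fin n} (k : Fin n)
    (h : i ≠ j ∧ ¬ H.Adj i j ∧ H.Adj i k ∧ H.Adj k j) : G.dist (f i) (f j) = 2 := by
  have := dist_map_ge_two hG f h.1 h.2.1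
  have := hG.dist_triangle (u := f i) (v := f k) (w := f j)
  rw [dist_map_eq_one f h.2.2.1, dist_map_eq_one f h.2.2.2] at this
  omega

theorem dist_map_eq_two_or_three (hG : G.Connected) (f : H ↪g G) {i j : Fin n} (k l : Fin n)
    (h : i ≠ j ∧ ¬ H.Adj i j ∧ H.Adj i k ∧ H.Adj k l ∧ H.Adj l j) :
    G.dist (f i) (f j) = 2 ∨ G.dist (f i) (f j) = 3 := by
  have := dist_map_ge_two hG f h.1 h.2.1
  have h1 := hG.dist_triangle (u := f i) (v := f k) (w := f j)
  have h2 := hG.dist_triangle (u := f k) (v := f l) (w := f j)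
  rw [dist_map_eq_one f h.2.2.1] at h1
  rw [dist_map_eq_one f h.2.2.2.1, dist_map_eq_one f h.2.2.2.2] at h2
  omega

theorem apply_eq_natCast (h : IsRankTwoCompletion G M) (f : H ↪g G) {i j : Fin n} (hne : i ≠ j)
    {d : ℕ} (hd : G.dist (f i) (f j) = d) : M (f i) (f j) = d := by
  rw [h.eq_dist _ _ (f.injective.ne hne), hd]

/-- The entries of a rank two completion at the images of disjoint triples are distances, so the
characteristic of the field divides the corresponding minor of the distance matrix. -/
theorem charP_dvd_minor3 (h : IsRankTwoCompletion G M) (p : ℕ) [CharP K p] (f : H ↪g G)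
    {a b c d e k : Fin n} (hd : ∀ x ∈ [a, b, c], ∀ y ∈ [d, e, k], x ≠ y) :
    (p : ℤ) ∣ minor3 (fun i j => (G.dist (f i) (f j) : ℤ)) a b c d e k := by
  rw [← CharP.intCast_eq_zero_iff K p, ← h.minor_eq_zero (f a) (f b) (f c) (f d) (f e) (f k)]
  have key : ∀ x ∈ [a, b, c], ∀ y ∈ [d, e, k], M (f x) (f y) = (G.dist (f x) (f y) : K) :=
    fun x hx y hy => h.eq_dist _ _ (f.injective.ne (hd x hx y hy))
  simp only [minor3]
  push_cast
  simp only [List.mem_cons, List.not_mem_nil, or_false, forall_eq_or_imp, forall_eq] at key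
  simp only [key]

theorem apply_eq_one (h : IsRankTwoCompletion G M) (f : H ↪g G) {i j : Fin n} (hij : H.Adj i j) :
    M (f i) (f j) = 1 := by
  rw [h.apply_eq_natCast f hij.ne (dist_map_eq_one f hij), Nat.cast_one]

theorem apply_eq_two (h : IsRankTwoCompletion G M) (hG : G.Connected) (f : H ↪g G) {i j : Fin n}
    (k : Fin n) (hij : i ≠ j ∧ ¬ H.Adj i j ∧ H.Adj i k ∧ H.Adj k j) : M (f i) (f j) = 2 := by
  rw [h.apply_eq_natCast f hij.1 (dist_map_eq_two hG f k hij), Nat.cast_ofNat]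

theorem apply_eq_two_or_three (h : IsRankTwoCompletion G M) (hG : G.Connected) (f : H ↪g G)
    {i j : Fin n} (k l : Fin n) (hij : i ≠ j ∧ ¬ H.Adj i j ∧ H.Adj i k ∧ H.Adj k l ∧ H.Adj l j) :
    M (f i) (f j) = 2 ∨ M (f i) (f j) = 3 := by
  rcases dist_map_eq_two_or_three hG f k l hij with hd | hd
  · left; rw [h.apply_eq_natCast f hij.1 hd, Nat.cast_ofNat]
  · right; rw [h.apply_eq_natCast f hij.1 hd, Nat.cast_ofNat]

/-- Coprime integers cannot both vanish in a field, whatever its characteristic, zero included. -/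
theorem false_of_charP_dvd (K : Type*) [Field K] {p : ℕ} [CharP K p] {a b : ℤ} (ha : (p : ℤ) ∣ a)
    (hb : (p : ℤ) ∣ b) (hab : Int.gcd a b = 1) : False := by
  have := Int.dvd_coe_gcd ha hb
  rw [hab, Nat.cast_one, Int.natCast_dvd_ofNat] at this
  exact CharP.char_ne_one K p (Nat.dvd_one.1 this)

/-- Two triples among five vertices always meet, so an unknown diagonal entry enters the minor. The
minors are chosen so that its cofactor vanishes and the rest is `1` or `-1`. The dart, house, gem
and full house below are treated in the same way. -/
theorem not_bull (h : IsRankTwoCompletion G M) (hG : G.Connected) : ¬ bull ⊴ G := by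
  rintro ⟨f⟩
  have h02 := h.apply_eq_two hG f (i := 0) (j := 2) 4 (by simp [bull])
  have h04 := h.apply_eq_one f (i := 0) (j := 4) (by simp [bull])
  have h31 := h.apply_eq_one f (i := 3) (j := 1) (by simp [bull])
  have h32 := h.apply_eq_one f (i := 3) (j := 2) (by simp [bull])
  have h34 := h.apply_eq_one f (i := 3) (j := 4) (by simp [bull])
  have h41 := h.apply_eq_two hG f (i := 4) (j := 1) 3 (by simp [bull])
  have h42 := h.apply_eq_one f (i := 4) (j := 2) (by simp [bull])
  have h03 := h.apply_eq_two hG f (i := 0) (j := 3) 4 (by simp [bull])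
  have h12 := h.apply_eq_two hG f (i := 1) (j := 2) 3 (by simp [bull])
  have h13 := h.apply_eq_one f (i := 1) (j := 3) (by simp [bull])
  have h43 := h.apply_eq_one f (i := 4) (j := 3) (by simp [bull])
  have h01 := h.apply_eq_two_or_three hG f (i := 0) (j := 1) 4 3 (by simp [bull])
  have m0 := h.minor_eq_zero (f 0) (f 3) (f 4) (f 1) (f 2) (f 4)
  have m1 := h.minor_eq_zero (f 0) (f 1) (f 4) (f 1) (f 2) (f 3)
  simp only [minor3, h02, h04, h31, h32, h34, h41, h42, h03, h12, h13, h43] at m0 m1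
  rcases h01 with h01 | h01
  · rw [h01] at m0; exact one_ne_zero (α := K) (by linear_combination m0)
  · rw [h01] at m1; exact one_ne_zero (α := K) (by linear_combination -m1)

theorem not_G69 (h : IsRankTwoCompletion G M) (hG : G.Connected) : ¬ G69 ⊴ G := by
  rintro ⟨f⟩
  have h13 := h.apply_eq_two hG f (i := 1) (j := 3) 5 (by simp [G69])
  have h15 := h.apply_eq_one f (i := 1) (j := 5) (by simp [G69])
  have h42 := h.apply_eq_one f (i := 4) (j := 2) (by simp [G69])
  have h43 := h.apply_eq_one f (i := 4) (j := 3) (by simp [G69])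
  have h45 := h.apply_eq_one f (i := 4) (j := 5) (by simp [G69])
  have h52 := h.apply_eq_two hG f (i := 5) (j := 2) 3 (by simp [G69])
  have h53 := h.apply_eq_one f (i := 5) (j := 3) (by simp [G69])
  have h04 := h.apply_eq_two hG f (i := 0) (j := 4) 5 (by simp [G69])
  have h05 := h.apply_eq_one f (i := 0) (j := 5) (by simp [G69])
  have h32 := h.apply_eq_one f (i := 3) (j := 2) (by simp [G69])
  have h34 := h.apply_eq_one f (i := 3) (j := 4) (by simp [G69])
  have h35 := h.apply_eq_one f (i := 3) (j := 5) (by simp [G69])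
  have h54 := h.apply_eq_one f (i := 5) (j := 4) (by simp [G69])
  have h14 := h.apply_eq_two hG f (i := 1) (j := 4) 5 (by simp [G69])
  have h10 := h.apply_eq_two hG f (i := 1) (j := 0) 5 (by simp [G69])
  have h40 := h.apply_eq_two hG f (i := 4) (j := 0) 5 (by simp [G69])
  have h50 := h.apply_eq_one f (i := 5) (j := 0) (by simp [G69])
  have h02 := h.apply_eq_two_or_three hG f (i := 0) (j := 2) 5 3 (by simp [G69])
  have h12 := h.apply_eq_two_or_three hG f (i := 1) (j := 2) 5 3 (by simp [G69])
  have m0 := h.minor_eq_zero (f 1) (f 4) (f 5) (f 2) (f 3) (f 5)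
  have m1 := h.minor_eq_zero (f 0) (f 3) (f 5) (f 2) (f 4) (f 5)
  have m2 := h.minor_eq_zero (f 0) (f 1) (f 3) (f 2) (f 4) (f 5)
  have m3 := h.minor_eq_zero (f 1) (f 4) (f 5) (f 0) (f 2) (f 3)
  simp only [minor3, h13, h15, h42, h43, h45, h52, h53, h04, h05, h32, h34, h35, h54, h14, h10,
    h40, h50] at m0 m1 m2 m3
  rcases h02 with h02 | h02 <;> rcases h12 with h12 | h12
  · rw [h12] at m0; exact one_ne_zero (α := K) (by linear_combination m0)
  · rw [h02] at m1; exact one_ne_zero (α := K) (by linear_combination m1)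
  · rw [h02, h12] at m2; exact one_ne_zero (α := K) (by linear_combination m2)
  · rw [h12] at m3; exact one_ne_zero (α := K) (by linear_combination m3)

theorem not_dart (h : IsRankTwoCompletion G M) (hG : G.Connected) : ¬ dart ⊴ G := by
  rintro ⟨f⟩
  have h02 := h.apply_eq_two hG f (i := 0) (j := 2) 4 (by simp [dart])
  have h03 := h.apply_eq_two hG f (i := 0) (j := 3) 4 (by simp [dart])
  have h04 := h.apply_eq_one f (i := 0) (j := 4) (by simp [dart])
  have h12 := h.apply_eq_two hG f (i := 1) (j := 2) 3 (by simp [dart])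
  have h13 := h.apply_eq_one f (i := 1) (j := 3) (by simp [dart])
  have h14 := h.apply_eq_one f (i := 1) (j := 4) (by simp [dart])
  have h32 := h.apply_eq_one f (i := 3) (j := 2) (by simp [dart])
  have h34 := h.apply_eq_one f (i := 3) (j := 4) (by simp [dart])
  have := h.minor_eq_zero (f 0) (f 1) (f 3) (f 2) (f 3) (f 4)
  simp only [minor3, h02, h03, h04, h12, h13, h14, h32, h34] at this
  exact one_ne_zero (α := K) (by linear_combination -this)

theorem not_house (h : IsRankTwoCompletion G M) (hG : G.Connected) : ¬ house ⊴ G := by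
  rintro ⟨f⟩
  have h01 := h.apply_eq_one f (i := 0) (j := 1) (by simp [house])
  have h02 := h.apply_eq_two hG f (i := 0) (j := 2) 4 (by simp [house])
  have h04 := h.apply_eq_one f (i := 0) (j := 4) (by simp [house])
  have h21 := h.apply_eq_two hG f (i := 2) (j := 1) 3 (by simp [house])
  have h24 := h.apply_eq_one f (i := 2) (j := 4) (by simp [house])
  have h31 := h.apply_eq_one f (i := 3) (j := 1) (by simp [house])
  have h32 := h.apply_eq_one f (i := 3) (j := 2) (by simp [house])
  have h34 := h.apply_eq_one f (i := 3) (j := 4) (by simp [house])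
  have := h.minor_eq_zero (f 0) (f 2) (f 3) (f 1) (f 2) (f 4)
  simp only [minor3, h01, h02, h04, h21, h24, h31, h32, h34] at this
  exact one_ne_zero (α := K) (by linear_combination -this)

theorem not_gem (h : IsRankTwoCompletion G M) (hG : G.Connected) : ¬ gem ⊴ G := by
  rintro ⟨f⟩
  have h01 := h.apply_eq_two hG f (i := 0) (j := 1) 4 (by simp [gem])
  have h03 := h.apply_eq_one f (i := 0) (j := 3) (by simp [gem])
  have h04 := h.apply_eq_one f (i := 0) (j := 4) (by simp [gem])
  have h13 := h.apply_eq_two hG f (i := 1) (j := 3) 2 (by simp [gem])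
  have h14 := h.apply_eq_one f (i := 1) (j := 4) (by simp [gem])
  have h21 := h.apply_eq_one f (i := 2) (j := 1) (by simp [gem])
  have h23 := h.apply_eq_one f (i := 2) (j := 3) (by simp [gem])
  have h24 := h.apply_eq_one f (i := 2) (j := 4) (by simp [gem])
  have := h.minor_eq_zero (f 0) (f 1) (f 2) (f 1) (f 3) (f 4)
  simp only [minor3, h01, h03, h04, h13, h14, h21, h23, h24] at this
  exact one_ne_zero (α := K) (by linear_combination this)

theorem not_fullHouse (h : IsRankTwoCompletion G M) (hG : G.Connected) : ¬ fullHouse ⊴ G := by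
  rintro ⟨f⟩
  have h02 := h.apply_eq_two hG f (i := 0) (j := 2) 3 (by simp [fullHouse])
  have h04 := h.apply_eq_one f (i := 0) (j := 4) (by simp [fullHouse])
  have h10 := h.apply_eq_two hG f (i := 1) (j := 0) 3 (by simp [fullHouse])
  have h12 := h.apply_eq_one f (i := 1) (j := 2) (by simp [fullHouse])
  have h14 := h.apply_eq_one f (i := 1) (j := 4) (by simp [fullHouse])
  have h30 := h.apply_eq_one f (i := 3) (j := 0) (by simp [fullHouse])
  have h32 := h.apply_eq_one f (i := 3) (j := 2) (by simp [fullHouse])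
  have h34 := h.apply_eq_one f (i := 3) (j := 4) (by simp [fullHouse])
  have := h.minor_eq_zero (f 0) (f 1) (f 3) (f 0) (f 2) (f 4)
  simp only [minor3, h02, h04, h10, h12, h14, h30, h32, h34] at this
  exact one_ne_zero (α := K) (by linear_combination -this)

/-- Six vertices allow disjoint row and column triples, so the minors are integers; for every
possible choice of the undetermined distances the two minors are coprime. -/
theorem not_G65 (h : IsRankTwoCompletion G M) (hG : G.Connected) : ¬ G65 ⊴ G := by
  rintro ⟨f⟩
  obtain ⟨p, hp⟩ := CharP.exists K
  have h03 := dist_map_eq_two_or_three hG f (i := 0) (j := 3) 4 5 (by simp [G65])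
  have h04 := dist_map_eq_one f (i := 0) (j := 4) (by simp [G65])
  have h05 := dist_map_eq_two hG f (i := 0) (j := 5) 4 (by simp [G65])
  have h13 := dist_map_eq_two hG f (i := 1) (j := 3) 5 (by simp [G65])
  have h14 := dist_map_eq_two hG f (i := 1) (j := 4) 5 (by simp [G65])
  have h15 := dist_map_eq_one f (i := 1) (j := 5) (by simp [G65])
  have h23 := dist_map_eq_one f (i := 2) (j := 3) (by simp [G65])
  have h24 := dist_map_eq_two hG f (i := 2) (j := 4) 5 (by simp [G65])
  have h25 := dist_map_eq_one f (i := 2) (j := 5) (by simp [G65])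
  have h01 := dist_map_eq_two_or_three hG f (i := 0) (j := 1) 4 5 (by simp [G65])
  have h21 := dist_map_eq_two hG f (i := 2) (j := 1) 5 (by simp [G65])
  have h41 := dist_map_eq_two hG f (i := 4) (j := 1) 5 (by simp [G65])
  have h43 := dist_map_eq_two hG f (i := 4) (j := 3) 5 (by simp [G65])
  have h45 := dist_map_eq_one f (i := 4) (j := 5) (by simp [G65])
  have m0 := h.charP_dvd_minor3 p f (a := 0) (b := 1) (c := 2) (d := 3) (e := 4) (k := 5)
    (by decide)
  have m1 := h.charP_dvd_minor3 p f (a := 0) (b := 2) (c := 4) (d := 1) (e := 3) (k := 5)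
    (by decide)
  simp only [minor3, h04, h05, h13, h14, h15, h23, h24, h25, h21, h41, h43, h45] at m0 m1
  rcases h03 with h03 | h03 <;> rcases h01 with h01 | h01 <;>
    exact false_of_charP_dvd K m0 m1 (by norm_num [h03, h01])

theorem not_fivePan (h : IsRankTwoCompletion G M) (hG : G.Connected) : ¬ fivePan ⊴ G := by
  rintro ⟨f⟩
  obtain ⟨p, hp⟩ := CharP.exists K
  have h03 := dist_map_eq_two hG f (i := 0) (j := 3) 5 (by simp [fivePan])
  have h04 := dist_map_eq_two hG f (i := 0) (j := 4) 5 (by simp [fivePan])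
  have h05 := dist_map_eq_one f (i := 0) (j := 5) (by simp [fivePan])
  have h13 := dist_map_eq_two hG f (i := 1) (j := 3) 2 (by simp [fivePan])
  have h14 := dist_map_eq_one f (i := 1) (j := 4) (by simp [fivePan])
  have h15 := dist_map_eq_two hG f (i := 1) (j := 5) 4 (by simp [fivePan])
  have h23 := dist_map_eq_one f (i := 2) (j := 3) (by simp [fivePan])
  have h24 := dist_map_eq_two hG f (i := 2) (j := 4) 1 (by simp [fivePan])
  have h25 := dist_map_eq_two hG f (i := 2) (j := 5) 3 (by simp [fivePan])
  have h02 := dist_map_eq_two_or_three hG f (i := 0) (j := 2) 5 3 (by simp [fivePan])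
  have h12 := dist_map_eq_one f (i := 1) (j := 2) (by simp [fivePan])
  have h32 := dist_map_eq_one f (i := 3) (j := 2) (by simp [fivePan])
  have h34 := dist_map_eq_two hG f (i := 3) (j := 4) 5 (by simp [fivePan])
  have h35 := dist_map_eq_one f (i := 3) (j := 5) (by simp [fivePan])
  have m0 := h.charP_dvd_minor3 p f (a := 0) (b := 1) (c := 2) (d := 3) (e := 4) (k := 5)
    (by decide)
  have m1 := h.charP_dvd_minor3 p f (a := 0) (b := 1) (c := 3) (d := 2) (e := 4) (k := 5)
    (by decide)
  simp only [minor3, h03, h04, h05, h13, h14, h15, h23, h24, h25, h12, h32, h34, h35] at m0 m1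
  rcases h02 with h02 | h02 <;>
    exact false_of_charP_dvd K m0 m1 (by norm_num [h02])

theorem not_G68 (h : IsRankTwoCompletion G M) (hG : G.Connected) : ¬ G68 ⊴ G := by
  rintro ⟨f⟩
  obtain ⟨p, hp⟩ := CharP.exists K
  have h03 := dist_map_eq_two hG f (i := 0) (j := 3) 5 (by simp [G68])
  have h04 := dist_map_eq_two hG f (i := 0) (j := 4) 5 (by simp [G68])
  have h05 := dist_map_eq_one f (i := 0) (j := 5) (by simp [G68])
  have h13 := dist_map_eq_two hG f (i := 1) (j := 3) 5 (by simp [G68])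
  have h14 := dist_map_eq_one f (i := 1) (j := 4) (by simp [G68])
  have h15 := dist_map_eq_one f (i := 1) (j := 5) (by simp [G68])
  have h23 := dist_map_eq_one f (i := 2) (j := 3) (by simp [G68])
  have h24 := dist_map_eq_two hG f (i := 2) (j := 4) 5 (by simp [G68])
  have h25 := dist_map_eq_one f (i := 2) (j := 5) (by simp [G68])
  have m0 := h.charP_dvd_minor3 p f (a := 0) (b := 1) (c := 2) (d := 3) (e := 4) (k := 5)
    (by decide)
  simp only [minor3, h03, h04, h05, h13, h14, h15, h23, h24, h25] at m0
  exact false_of_charP_dvd K m0 m0 (by norm_num [])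

theorem not_G610 (h : IsRankTwoCompletion G M) (hG : G.Connected) : ¬ G610 ⊴ G := by
  rintro ⟨f⟩
  obtain ⟨p, hp⟩ := CharP.exists K
  have h03 := dist_map_eq_two hG f (i := 0) (j := 3) 5 (by simp [G610])
  have h04 := dist_map_eq_two hG f (i := 0) (j := 4) 1 (by simp [G610])
  have h05 := dist_map_eq_one f (i := 0) (j := 5) (by simp [G610])
  have h13 := dist_map_eq_two hG f (i := 1) (j := 3) 4 (by simp [G610])
  have h14 := dist_map_eq_one f (i := 1) (j := 4) (by simp [G610])
  have h15 := dist_map_eq_two hG f (i := 1) (j := 5) 0 (by simp [G610])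
  have h23 := dist_map_eq_two hG f (i := 2) (j := 3) 4 (by simp [G610])
  have h24 := dist_map_eq_one f (i := 2) (j := 4) (by simp [G610])
  have h25 := dist_map_eq_one f (i := 2) (j := 5) (by simp [G610])
  have h01 := dist_map_eq_one f (i := 0) (j := 1) (by simp [G610])
  have h21 := dist_map_eq_two hG f (i := 2) (j := 1) 4 (by simp [G610])
  have h41 := dist_map_eq_one f (i := 4) (j := 1) (by simp [G610])
  have h43 := dist_map_eq_one f (i := 4) (j := 3) (by simp [G610])
  have h45 := dist_map_eq_two hG f (i := 4) (j := 5) 2 (by simp [G610])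
  have m0 := h.charP_dvd_minor3 p f (a := 0) (b := 1) (c := 2) (d := 3) (e := 4) (k := 5)
    (by decide)
  have m1 := h.charP_dvd_minor3 p f (a := 0) (b := 2) (c := 4) (d := 1) (e := 3) (k := 5)
    (by decide)
  simp only [minor3, h03, h04, h05, h13, h14, h15, h23, h24, h25, h01, h21, h41, h43, h45] at m0 m1
  exact false_of_charP_dvd K m0 m1 (by norm_num [])

theorem not_G612 (h : IsRankTwoCompletion G M) (hG : G.Connected) : ¬ G612 ⊴ G := by
  rintro ⟨f⟩
  obtain ⟨p, hp⟩ := CharP.exists K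
  have h03 := dist_map_eq_two hG f (i := 0) (j := 3) 5 (by simp [G612])
  have h04 := dist_map_eq_two_or_three hG f (i := 0) (j := 4) 5 1 (by simp [G612])
  have h05 := dist_map_eq_one f (i := 0) (j := 5) (by simp [G612])
  have h13 := dist_map_eq_two hG f (i := 1) (j := 3) 4 (by simp [G612])
  have h14 := dist_map_eq_one f (i := 1) (j := 4) (by simp [G612])
  have h15 := dist_map_eq_one f (i := 1) (j := 5) (by simp [G612])
  have h23 := dist_map_eq_one f (i := 2) (j := 3) (by simp [G612])
  have h24 := dist_map_eq_one f (i := 2) (j := 4) (by simp [G612])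
  have h25 := dist_map_eq_one f (i := 2) (j := 5) (by simp [G612])
  have h01 := dist_map_eq_two hG f (i := 0) (j := 1) 5 (by simp [G612])
  have h21 := dist_map_eq_two hG f (i := 2) (j := 1) 4 (by simp [G612])
  have h41 := dist_map_eq_one f (i := 4) (j := 1) (by simp [G612])
  have h43 := dist_map_eq_one f (i := 4) (j := 3) (by simp [G612])
  have h45 := dist_map_eq_two hG f (i := 4) (j := 5) 1 (by simp [G612])
  have m0 := h.charP_dvd_minor3 p f (a := 0) (b := 1) (c := 2) (d := 3) (e := 4) (k := 5)
    (by decide)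
  have m1 := h.charP_dvd_minor3 p f (a := 0) (b := 2) (c := 4) (d := 1) (e := 3) (k := 5)
    (by decide)
  simp only [minor3, h03, h05, h13, h14, h15, h23, h24, h25, h01, h21, h41, h43, h45] at m0 m1
  rcases h04 with h04 | h04 <;>
    exact false_of_charP_dvd K m0 m1 (by norm_num [h04])

theorem not_coTwinC5 (h : IsRankTwoCompletion G M) (hG : G.Connected) : ¬ coTwinC5 ⊴ G := by
  rintro ⟨f⟩
  obtain ⟨p, hp⟩ := CharP.exists K
  have h03 := dist_map_eq_two hG f (i := 0) (j := 3) 5 (by simp [coTwinC5])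
  have h04 := dist_map_eq_two hG f (i := 0) (j := 4) 1 (by simp [coTwinC5])
  have h05 := dist_map_eq_one f (i := 0) (j := 5) (by simp [coTwinC5])
  have h13 := dist_map_eq_two hG f (i := 1) (j := 3) 4 (by simp [coTwinC5])
  have h14 := dist_map_eq_one f (i := 1) (j := 4) (by simp [coTwinC5])
  have h15 := dist_map_eq_two hG f (i := 1) (j := 5) 0 (by simp [coTwinC5])
  have h23 := dist_map_eq_one f (i := 2) (j := 3) (by simp [coTwinC5])
  have h24 := dist_map_eq_one f (i := 2) (j := 4) (by simp [coTwinC5])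
  have h25 := dist_map_eq_one f (i := 2) (j := 5) (by simp [coTwinC5])
  have m0 := h.charP_dvd_minor3 p f (a := 0) (b := 1) (c := 2) (d := 3) (e := 4) (k := 5)
    (by decide)
  simp only [minor3, h03, h04, h05, h13, h14, h15, h23, h24, h25] at m0
  exact false_of_charP_dvd K m0 m0 (by norm_num [])

theorem not_G614 (h : IsRankTwoCompletion G M) (hG : G.Connected) : ¬ G614 ⊴ G := by
  rintro ⟨f⟩
  obtain ⟨p, hp⟩ := CharP.exists K
  have h01 := dist_map_eq_two hG f (i := 0) (j := 1) 2 (by simp [G614])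
  have h03 := dist_map_eq_one f (i := 0) (j := 3) (by simp [G614])
  have h05 := dist_map_eq_one f (i := 0) (j := 5) (by simp [G614])
  have h21 := dist_map_eq_one f (i := 2) (j := 1) (by simp [G614])
  have h23 := dist_map_eq_two hG f (i := 2) (j := 3) 0 (by simp [G614])
  have h25 := dist_map_eq_one f (i := 2) (j := 5) (by simp [G614])
  have h41 := dist_map_eq_one f (i := 4) (j := 1) (by simp [G614])
  have h43 := dist_map_eq_one f (i := 4) (j := 3) (by simp [G614])
  have h45 := dist_map_eq_one f (i := 4) (j := 5) (by simp [G614])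
  have m0 := h.charP_dvd_minor3 p f (a := 0) (b := 2) (c := 4) (d := 1) (e := 3) (k := 5)
    (by decide)
  simp only [minor3, h01, h03, h05, h21, h23, h25, h41, h43, h45] at m0
  exact false_of_charP_dvd K m0 m0 (by norm_num [])

theorem not_G615 (h : IsRankTwoCompletion G M) (hG : G.Connected) : ¬ G615 ⊴ G := by
  rintro ⟨f⟩
  obtain ⟨p, hp⟩ := CharP.exists K
  have h01 := dist_map_eq_one f (i := 0) (j := 1) (by simp [G615])
  have h03 := dist_map_eq_two_or_three hG f (i := 0) (j := 3) 6 4 (by simp [G615])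
  have h05 := dist_map_eq_two hG f (i := 0) (j := 5) 6 (by simp [G615])
  have h21 := dist_map_eq_two_or_three hG f (i := 2) (j := 1) 4 6 (by simp [G615])
  have h23 := dist_map_eq_two hG f (i := 2) (j := 3) 4 (by simp [G615])
  have h25 := dist_map_eq_one f (i := 2) (j := 5) (by simp [G615])
  have h41 := dist_map_eq_two hG f (i := 4) (j := 1) 6 (by simp [G615])
  have h43 := dist_map_eq_one f (i := 4) (j := 3) (by simp [G615])
  have h45 := dist_map_eq_two hG f (i := 4) (j := 5) 2 (by simp [G615])
  have h06 := dist_map_eq_one f (i := 0) (j := 6) (by simp [G615])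
  have h26 := dist_map_eq_two hG f (i := 2) (j := 6) 4 (by simp [G615])
  have h46 := dist_map_eq_one f (i := 4) (j := 6) (by simp [G615])
  have m0 := h.charP_dvd_minor3 p f (a := 0) (b := 2) (c := 4) (d := 1) (e := 3) (k := 5)
    (by decide)
  have m1 := h.charP_dvd_minor3 p f (a := 0) (b := 2) (c := 4) (d := 1) (e := 3) (k := 6)
    (by decide)
  simp only [minor3, h01, h05, h23, h25, h41, h43, h45, h06, h26, h46] at m0 m1
  rcases h03 with h03 | h03 <;> rcases h21 with h21 | h21 <;>
    exact false_of_charP_dvd K m0 m1 (by norm_num [h03, h21])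

end IsRankTwoCompletion

/-! ### Forbidden induced subgraphs as adjacency patterns. -/

namespace ForbiddenGraph

variable {V : Type*} {G : SimpleGraph V}

theorem isIndContained_of_forall_lt {n : ℕ} {H : SimpleGraph (Fin n)} (f : Fin n → V)
    (h : ∀ i j, i < j → f i ≠ f j ∧ (G.Adj (f i) (f j) ↔ H.Adj i j)) : H ⊴ G := by
  have hne : ∀ i j, i ≠ j → f i ≠ f j := fun i j hij =>
    hij.lt_or_gt.elim (fun hlt => (h i j hlt).1) fun hlt => (h j i hlt).1.symm
  refine ⟨⟨⟨f, fun i j hij => not_not.1 fun hn => hne i j hn hij⟩, fun {i j} => ?_⟩⟩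
  change G.Adj (f i) (f j) ↔ H.Adj i j
  rcases lt_trichotomy i j with hlt | rfl | hlt
  · exact (h i j hlt).2
  · simp
  · rw [G.adj_comm, H.adj_comm]; exact (h j i hlt).2

/-- These patterns feed automated case analysis on adjacencies. Inequalities are required only for
nonadjacent vertices with equal neighborhoods in the forbidden graph; all other vertices are kept
apart by the adjacencies themselves. -/
theorem bull_not_pattern (hF : ¬ bull ⊴ G) (a b c d e : V) :
    ¬ (G.Adj a e ∧ G.Adj b d ∧ G.Adj c d ∧ G.Adj c e ∧ G.Adj d e ∧ ¬ G.Adj a b ∧ ¬ G.Adj a c ∧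
      ¬ G.Adj a d ∧ ¬ G.Adj b c ∧ ¬ G.Adj b e) := by
  intro h
  refine hF (isIndContained_of_forall_lt ![a, b, c, d, e] ?_)
  simp [Fin.forall_fin_succ, bull, h]
  grind [G.adj_comm, Adj.ne]

theorem dart_not_pattern (hF : ¬ dart ⊴ G) (a b c d e : V) :
    ¬ (G.Adj a e ∧ G.Adj b d ∧ G.Adj b e ∧ G.Adj c d ∧ G.Adj c e ∧ G.Adj d e ∧ ¬ G.Adj a b ∧
      ¬ G.Adj a c ∧ ¬ G.Adj a d ∧ ¬ G.Adj b c ∧ b ≠ c) := by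
  intro h
  refine hF (isIndContained_of_forall_lt ![a, b, c, d, e] ?_)
  simp [Fin.forall_fin_succ, dart, h]
  grind [G.adj_comm, Adj.ne]

theorem house_not_pattern (hF : ¬ house ⊴ G) (a b c d e : V) :
    ¬ (G.Adj a b ∧ G.Adj a e ∧ G.Adj b d ∧ G.Adj c d ∧ G.Adj c e ∧ G.Adj d e ∧ ¬ G.Adj a c ∧
      ¬ G.Adj a d ∧ ¬ G.Adj b c ∧ ¬ G.Adj b e) := by
  intro h
  refine hF (isIndContained_of_forall_lt ![a, b, c, d, e] ?_)
  simp [Fin.forall_fin_succ, house, h]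
  grind [G.adj_comm, Adj.ne]

theorem gem_not_pattern (hF : ¬ gem ⊴ G) (a b c d e : V) :
    ¬ (G.Adj a d ∧ G.Adj a e ∧ G.Adj b c ∧ G.Adj b e ∧ G.Adj c d ∧ G.Adj c e ∧ G.Adj d e ∧
      ¬ G.Adj a b ∧ ¬ G.Adj a c ∧ ¬ G.Adj b d) := by
  intro h
  refine hF (isIndContained_of_forall_lt ![a, b, c, d, e] ?_)
  simp [Fin.forall_fin_succ, gem, h]
  grind [G.adj_comm, Adj.ne]

theorem fullHouse_not_pattern (hF : ¬ fullHouse ⊴ G) (a b c d e : V) :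
    ¬ (G.Adj a d ∧ G.Adj a e ∧ G.Adj b c ∧ G.Adj b d ∧ G.Adj b e ∧ G.Adj c d ∧ G.Adj c e ∧
      G.Adj d e ∧ ¬ G.Adj a b ∧ ¬ G.Adj a c) := by
  intro h
  refine hF (isIndContained_of_forall_lt ![a, b, c, d, e] ?_)
  simp [Fin.forall_fin_succ, fullHouse, h]
  grind [G.adj_comm, Adj.ne]

theorem G65_not_pattern (hF : ¬ G65 ⊴ G) (a b c d e f : V) :
    ¬ (G.Adj a e ∧ G.Adj b f ∧ G.Adj c d ∧ G.Adj c f ∧ G.Adj d f ∧ G.Adj e f ∧ ¬ G.Adj a b ∧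
      ¬ G.Adj a c ∧ ¬ G.Adj a d ∧ ¬ G.Adj a f ∧ ¬ G.Adj b c ∧ ¬ G.Adj b d ∧ ¬ G.Adj b e ∧
      ¬ G.Adj c e ∧ ¬ G.Adj d e) := by
  intro h
  refine hF (isIndContained_of_forall_lt ![a, b, c, d, e, f] ?_)
  simp [Fin.forall_fin_succ, G65, h]
  grind [G.adj_comm, Adj.ne]

theorem fivePan_not_pattern (hF : ¬ fivePan ⊴ G) (a b c d e f : V) :
    ¬ (G.Adj a f ∧ G.Adj b c ∧ G.Adj b e ∧ G.Adj c d ∧ G.Adj d f ∧ G.Adj e f ∧ ¬ G.Adj a b ∧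
      ¬ G.Adj a c ∧ ¬ G.Adj a d ∧ ¬ G.Adj a e ∧ ¬ G.Adj b d ∧ ¬ G.Adj b f ∧ ¬ G.Adj c e ∧
      ¬ G.Adj c f ∧ ¬ G.Adj d e) := by
  intro h
  refine hF (isIndContained_of_forall_lt ![a, b, c, d, e, f] ?_)
  simp [Fin.forall_fin_succ, fivePan, h]
  grind [G.adj_comm, Adj.ne]

theorem G67_not_pattern (hF : ¬ G67 ⊴ G) (a b c d e f : V) :
    ¬ (G.Adj a e ∧ G.Adj b c ∧ G.Adj b f ∧ G.Adj c f ∧ G.Adj d e ∧ G.Adj d f ∧ ¬ G.Adj a b ∧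
      ¬ G.Adj a c ∧ ¬ G.Adj a d ∧ ¬ G.Adj a f ∧ ¬ G.Adj b d ∧ ¬ G.Adj b e ∧ ¬ G.Adj c d ∧
      ¬ G.Adj c e ∧ ¬ G.Adj e f) := by
  intro h
  refine hF (isIndContained_of_forall_lt ![a, b, c, d, e, f] ?_)
  simp [Fin.forall_fin_succ, G67, h]
  grind [G.adj_comm, Adj.ne]

theorem G68_not_pattern (hF : ¬ G68 ⊴ G) (a b c d e f : V) :
    ¬ (G.Adj a f ∧ G.Adj b e ∧ G.Adj b f ∧ G.Adj c d ∧ G.Adj c f ∧ G.Adj d f ∧ G.Adj e f ∧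
      ¬ G.Adj a b ∧ ¬ G.Adj a c ∧ ¬ G.Adj a d ∧ ¬ G.Adj a e ∧ ¬ G.Adj b c ∧ ¬ G.Adj b d ∧
      ¬ G.Adj c e ∧ ¬ G.Adj d e) := by
  intro h
  refine hF (isIndContained_of_forall_lt ![a, b, c, d, e, f] ?_)
  simp [Fin.forall_fin_succ, G68, h]
  grind [G.adj_comm, Adj.ne]

theorem G69_not_pattern (hF : ¬ G69 ⊴ G) (a b c d e f : V) :
    ¬ (G.Adj a f ∧ G.Adj b f ∧ G.Adj c d ∧ G.Adj c e ∧ G.Adj d e ∧ G.Adj d f ∧ G.Adj e f ∧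
      ¬ G.Adj a b ∧ ¬ G.Adj a c ∧ ¬ G.Adj a d ∧ ¬ G.Adj a e ∧ ¬ G.Adj b c ∧ ¬ G.Adj b d ∧
      ¬ G.Adj b e ∧ ¬ G.Adj c f ∧ a ≠ b) := by
  intro h
  refine hF (isIndContained_of_forall_lt ![a, b, c, d, e, f] ?_)
  simp [Fin.forall_fin_succ, G69, h]
  grind [G.adj_comm, Adj.ne]

theorem G610_not_pattern (hF : ¬ G610 ⊴ G) (a b c d e f : V) :
    ¬ (G.Adj a b ∧ G.Adj a f ∧ G.Adj b e ∧ G.Adj c e ∧ G.Adj c f ∧ G.Adj d e ∧ G.Adj d f ∧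
      ¬ G.Adj a c ∧ ¬ G.Adj a d ∧ ¬ G.Adj a e ∧ ¬ G.Adj b c ∧ ¬ G.Adj b d ∧ ¬ G.Adj b f ∧
      ¬ G.Adj c d ∧ ¬ G.Adj e f ∧ c ≠ d) := by
  intro h
  refine hF (isIndContained_of_forall_lt ![a, b, c, d, e, f] ?_)
  simp [Fin.forall_fin_succ, G610, h]
  grind [G.adj_comm, Adj.ne]

theorem coTwinHouse_not_pattern (hF : ¬ coTwinHouse ⊴ G) (a b c d e f : V) :
    ¬ (G.Adj a f ∧ G.Adj b e ∧ G.Adj c d ∧ G.Adj c e ∧ G.Adj c f ∧ G.Adj d e ∧ G.Adj d f ∧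
      ¬ G.Adj a b ∧ ¬ G.Adj a c ∧ ¬ G.Adj a d ∧ ¬ G.Adj a e ∧ ¬ G.Adj b c ∧ ¬ G.Adj b d ∧
      ¬ G.Adj b f ∧ ¬ G.Adj e f) := by
  intro h
  refine hF (isIndContained_of_forall_lt ![a, b, c, d, e, f] ?_)
  simp [Fin.forall_fin_succ, coTwinHouse, h]
  grind [G.adj_comm, Adj.ne]

theorem G612_not_pattern (hF : ¬ G612 ⊴ G) (a b c d e f : V) :
    ¬ (G.Adj a f ∧ G.Adj b e ∧ G.Adj b f ∧ G.Adj c d ∧ G.Adj c e ∧ G.Adj c f ∧ G.Adj d e ∧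
      G.Adj d f ∧ ¬ G.Adj a b ∧ ¬ G.Adj a c ∧ ¬ G.Adj a d ∧ ¬ G.Adj a e ∧ ¬ G.Adj b c ∧
      ¬ G.Adj b d ∧ ¬ G.Adj e f) := by
  intro h
  refine hF (isIndContained_of_forall_lt ![a, b, c, d, e, f] ?_)
  simp [Fin.forall_fin_succ, G612, h]
  grind [G.adj_comm, Adj.ne]

theorem coTwinC5_not_pattern (hF : ¬ coTwinC5 ⊴ G) (a b c d e f : V) :
    ¬ (G.Adj a b ∧ G.Adj a f ∧ G.Adj b e ∧ G.Adj c d ∧ G.Adj c e ∧ G.Adj c f ∧ G.Adj d e ∧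
      G.Adj d f ∧ ¬ G.Adj a c ∧ ¬ G.Adj a d ∧ ¬ G.Adj a e ∧ ¬ G.Adj b c ∧ ¬ G.Adj b d ∧
      ¬ G.Adj b f ∧ ¬ G.Adj e f) := by
  intro h
  refine hF (isIndContained_of_forall_lt ![a, b, c, d, e, f] ?_)
  simp [Fin.forall_fin_succ, coTwinC5, h]
  grind [G.adj_comm, Adj.ne]

theorem G614_not_pattern (hF : ¬ G614 ⊴ G) (a b c d e f : V) :
    ¬ (G.Adj a c ∧ G.Adj a d ∧ G.Adj a e ∧ G.Adj a f ∧ G.Adj b c ∧ G.Adj b d ∧ G.Adj b e ∧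
      G.Adj b f ∧ G.Adj c e ∧ G.Adj c f ∧ G.Adj d e ∧ G.Adj d f ∧ G.Adj e f ∧ ¬ G.Adj a b ∧
      ¬ G.Adj c d ∧ a ≠ b ∧ c ≠ d) := by
  intro h
  refine hF (isIndContained_of_forall_lt ![a, b, c, d, e, f] ?_)
  simp [Fin.forall_fin_succ, G614, h]
  grind [G.adj_comm, Adj.ne]

theorem G615_not_pattern (hF : ¬ G615 ⊴ G) (a b c d e f g : V) :
    ¬ (G.Adj a b ∧ G.Adj a g ∧ G.Adj b g ∧ G.Adj c e ∧ G.Adj c f ∧ G.Adj d e ∧ G.Adj d f ∧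
      G.Adj e g ∧ G.Adj f g ∧ ¬ G.Adj a c ∧ ¬ G.Adj a d ∧ ¬ G.Adj a e ∧ ¬ G.Adj a f ∧ ¬ G.Adj b c ∧
      ¬ G.Adj b d ∧ ¬ G.Adj b e ∧ ¬ G.Adj b f ∧ ¬ G.Adj c d ∧ ¬ G.Adj c g ∧ ¬ G.Adj d g ∧
      ¬ G.Adj e f ∧ c ≠ d ∧ e ≠ f) := by
  intro h
  refine hF (isIndContained_of_forall_lt ![a, b, c, d, e, f, g] ?_)
  simp [Fin.forall_fin_succ, G615, h]
  grind [G.adj_comm, Adj.ne]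
end ForbiddenGraph

/-- `G` has no induced subgraph in the family of forbidden graphs, `G67` and `coTwinHouse` aside. -/
structure CoreFree {V : Type*} (G : SimpleGraph V) : Prop where
  bull : ¬ bull ⊴ G
  dart : ¬ dart ⊴ G
  house : ¬ house ⊴ G
  gem : ¬ gem ⊴ G
  fullHouse : ¬ fullHouse ⊴ G
  G65 : ¬ G65 ⊴ G
  fivePan : ¬ fivePan ⊴ G
  G68 : ¬ G68 ⊴ G
  G69 : ¬ G69 ⊴ G
  G610 : ¬ G610 ⊴ G
  G612 : ¬ G612 ⊴ G
  coTwinC5 : ¬ coTwinC5 ⊴ G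
  G614 : ¬ G614 ⊴ G
  G615 : ¬ G615 ⊴ G

/-! ### Short paths that cannot be attached to an induced subgraph. -/

namespace ForbiddenGraph

variable {V : Type*} {G : SimpleGraph V}

theorem cycleGraph_seven_not_pattern (h7 : ¬ cycleGraph 7 ⊴ G) (a b c d e f g : V) :
    ¬ (G.Adj a b ∧ G.Adj a g ∧ G.Adj b c ∧ G.Adj c d ∧ G.Adj d e ∧ G.Adj e f ∧ G.Adj f g ∧
      ¬ G.Adj a c ∧ ¬ G.Adj a d ∧ ¬ G.Adj a e ∧ ¬ G.Adj a f ∧ ¬ G.Adj b d ∧ ¬ G.Adj b e ∧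
      ¬ G.Adj b f ∧ ¬ G.Adj b g ∧ ¬ G.Adj c e ∧ ¬ G.Adj c f ∧ ¬ G.Adj c g ∧ ¬ G.Adj d f ∧
      ¬ G.Adj d g ∧ ¬ G.Adj e g) := by
  intro h
  refine h7 (isIndContained_of_forall_lt ![a, b, c, d, e, f, g] ?_)
  simp +decide [Fin.forall_fin_succ, cycleGraph_adj, h]
  grind (splits := 25) [G.adj_comm, Adj.ne]

/-- `G67` is a triangle with a path of three edges attached. Each way for the new vertex `u` to see
the remaining vertices completes one of the cited patterns. This and the next two lemmas serve to
determine ambient distances in `not_G67`. -/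
theorem no_G67_extension_one_four (hF : CoreFree G) (a b c d e f u : V) :
    ¬ (G.Adj a e ∧ G.Adj b c ∧ G.Adj b f ∧ G.Adj c f ∧ G.Adj d e ∧ G.Adj d f ∧ G.Adj u b ∧
      G.Adj u e ∧ ¬ G.Adj a b ∧ ¬ G.Adj a c ∧ ¬ G.Adj a d ∧ ¬ G.Adj a f ∧ ¬ G.Adj b d ∧
      ¬ G.Adj b e ∧ ¬ G.Adj c d ∧ ¬ G.Adj c e ∧ ¬ G.Adj e f) := by
  grind [
    G.adj_comm, bull_not_pattern hF.bull a b d u e, bull_not_pattern hF.bull b d a e u,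
    dart_not_pattern hF.dart b a d e u, fivePan_not_pattern hF.fivePan a b f d u e,
    house_not_pattern hF.house d e b u f]

theorem no_G67_extension_zero_five (hF : CoreFree G) (a b c d e f u : V) :
    ¬ (G.Adj a e ∧ G.Adj b c ∧ G.Adj b f ∧ G.Adj c f ∧ G.Adj d e ∧ G.Adj d f ∧ G.Adj u a ∧
      G.Adj u f ∧ ¬ G.Adj a b ∧ ¬ G.Adj a c ∧ ¬ G.Adj a d ∧ ¬ G.Adj a f ∧ ¬ G.Adj b d ∧
      ¬ G.Adj b e ∧ ¬ G.Adj c d ∧ ¬ G.Adj c e ∧ ¬ G.Adj e f) := by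
  grind [
    G.adj_comm, bull_not_pattern hF.bull a b d f u, bull_not_pattern hF.bull a d b f u,
    dart_not_pattern hF.dart a b d f u, fivePan_not_pattern hF.fivePan b a e d u f,
    house_not_pattern hF.house d f a u e]

theorem no_G67_path_extension (hF : CoreFree G) (h7 : ¬ cycleGraph 7 ⊴ G) (a b c d e f s t : V) :
    ¬ (G.Adj a e ∧ G.Adj b c ∧ G.Adj b f ∧ G.Adj c f ∧ G.Adj d e ∧ G.Adj d f ∧ G.Adj s a ∧
      G.Adj s t ∧ G.Adj t b ∧ ¬ G.Adj a b ∧ ¬ G.Adj a c ∧ ¬ G.Adj a d ∧ ¬ G.Adj a f ∧ ¬ G.Adj b d ∧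
      ¬ G.Adj b e ∧ ¬ G.Adj c d ∧ ¬ G.Adj c e ∧ ¬ G.Adj e f ∧ ¬ G.Adj s b ∧ ¬ G.Adj t a) := by
  grind [
    G.adj_comm, bull_not_pattern hF.bull a b d f s, bull_not_pattern hF.bull a b d t e,
    fivePan_not_pattern hF.fivePan a b f d t e, fivePan_not_pattern hF.fivePan b a e d s f,
    bull_not_pattern hF.bull a b d t s, bull_not_pattern hF.bull c d a e s,
    fivePan_not_pattern hF.fivePan a b f d t s, fivePan_not_pattern hF.fivePan b a e d s t,
    G65_not_pattern hF.G65 a d b c s f, house_not_pattern hF.house d s b t f,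
    bull_not_pattern hF.bull d s b t f, cycleGraph_seven_not_pattern h7 a e d f b t s,
    house_not_pattern hF.house d t a s e, bull_not_pattern hF.bull d t a s e]

/-- The co-twin-house is a diamond with a pendant vertex at each of its two nonadjacent vertices.
This lemma and the next prevent the two pendant vertices from being at distance two or three. -/
theorem no_coTwinHouse_extension_zero_one (hF : CoreFree G) (h67 : ¬ G67 ⊴ G) (a b c d e f u : V) :
    ¬ (G.Adj a f ∧ G.Adj b e ∧ G.Adj c d ∧ G.Adj c e ∧ G.Adj c f ∧ G.Adj d e ∧ G.Adj d f ∧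
      G.Adj u a ∧ G.Adj u b ∧ ¬ G.Adj a b ∧ ¬ G.Adj a c ∧ ¬ G.Adj a d ∧ ¬ G.Adj a e ∧ ¬ G.Adj b c ∧
      ¬ G.Adj b d ∧ ¬ G.Adj b f ∧ ¬ G.Adj e f) := by
  grind [
    G.adj_comm, bull_not_pattern hF.bull a c b e u, dart_not_pattern hF.dart a b c e u,
    G612_not_pattern hF.G612 a b c d e u, G67_not_pattern h67 a c d b u e,
    house_not_pattern hF.house b u c d e, house_not_pattern hF.house b u d c e]

theorem no_coTwinHouse_path_extension (hF : CoreFree G) (h67 : ¬ G67 ⊴ G)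
    (h7 : ¬ cycleGraph 7 ⊴ G) (a b c d e f s t : V) :
    ¬ (G.Adj a f ∧ G.Adj b e ∧ G.Adj c d ∧ G.Adj c e ∧ G.Adj c f ∧ G.Adj d e ∧ G.Adj d f ∧
      G.Adj s a ∧ G.Adj s t ∧ G.Adj t b ∧ ¬ G.Adj a b ∧ ¬ G.Adj a c ∧ ¬ G.Adj a d ∧ ¬ G.Adj a e ∧
      ¬ G.Adj b c ∧ ¬ G.Adj b d ∧ ¬ G.Adj b f ∧ ¬ G.Adj e f ∧ ¬ G.Adj s b ∧ ¬ G.Adj t a) := by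
  grind [
    G.adj_comm, bull_not_pattern hF.bull a b c e s, bull_not_pattern hF.bull a b c t f,
    bull_not_pattern hF.bull a b d t s, G65_not_pattern hF.G65 a b c d s e,
    G67_not_pattern h67 b a s d e f, G65_not_pattern hF.G65 b a c d t f,
    G67_not_pattern h67 a b t d f e, fivePan_not_pattern hF.fivePan a b e d t s,
    fivePan_not_pattern hF.fivePan b a f d s t, cycleGraph_seven_not_pattern h7 a f d e b t s,
    bull_not_pattern hF.bull a b d e s, bull_not_pattern hF.bull a b d t f]

/-- If no further adjacencies occur, the two paths between `a` and `e` close up to an induced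
7-cycle; every additional adjacency leads to a smaller forbidden graph. It shows that the ends of an
induced path on five vertices are never at distance three. -/
theorem no_path_five_extension (hF : CoreFree G) (h7 : ¬ cycleGraph 7 ⊴ G) (a b c d e s t : V) :
    ¬ (G.Adj a b ∧ G.Adj b c ∧ G.Adj c d ∧ G.Adj d e ∧ G.Adj s a ∧ G.Adj s t ∧ G.Adj t e ∧
      ¬ G.Adj a c ∧ ¬ G.Adj a d ∧ ¬ G.Adj a e ∧ ¬ G.Adj b d ∧ ¬ G.Adj b e ∧ ¬ G.Adj c e ∧
      ¬ G.Adj s e ∧ ¬ G.Adj t a) := by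
  grind [
    G.adj_comm, bull_not_pattern hF.bull a e c d s, bull_not_pattern hF.bull a e c t b,
    fivePan_not_pattern hF.fivePan a d e t c b, house_not_pattern hF.house b c e d t,
    fivePan_not_pattern hF.fivePan e a b c s d, bull_not_pattern hF.bull a e c t s,
    bull_not_pattern hF.bull c t a s b, house_not_pattern hF.house c t a s b,
    fivePan_not_pattern hF.fivePan a d e t c s, fivePan_not_pattern hF.fivePan e a b c s t,
    house_not_pattern hF.house c s e t d, cycleGraph_seven_not_pattern h7 a b c d e t s,
    bull_not_pattern hF.bull c s e t d]

theorem no_cycle_five_extension (hF : CoreFree G) (a b c d e w : V)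
    (hb : w ≠ b) (he : w ≠ e) :
    ¬ (G.Adj a b ∧ G.Adj b c ∧ G.Adj c d ∧ G.Adj d e ∧ G.Adj a e ∧ G.Adj w a ∧ ¬ G.Adj a c ∧
      ¬ G.Adj a d ∧ ¬ G.Adj b d ∧ ¬ G.Adj b e ∧ ¬ G.Adj c e) := by
  grind [
    G.adj_comm, bull_not_pattern hF.bull b d w e a, bull_not_pattern hF.bull c e w a b,
    gem_not_pattern hF.gem a c d e w, house_not_pattern hF.house a e c d w,
    fivePan_not_pattern hF.fivePan w c d e b a, G610_not_pattern hF.G610 b c e w d a,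
    G610_not_pattern hF.G610 d e b w a c, coTwinC5_not_pattern hF.coTwinC5 b c e w d a,
    coTwinC5_not_pattern hF.coTwinC5 c d a w e b, coTwinC5_not_pattern hF.coTwinC5 d e b w a c,
    gem_not_pattern hF.gem b d e a w, gem_not_pattern hF.gem c e a b w]

end ForbiddenGraph

/-! ### Shortest paths of length two and three. -/

section Walks

variable {V : Type*} {G : SimpleGraph V}

theorem exists_adj_dist_eq (hG : G.Connected) {u v : V} {k : ℕ} (h : G.dist u v = k + 1) :
    ∃ w, G.Adj u w ∧ G.dist w v = k := by
  obtain ⟨p, hp⟩ := hG.exists_walk_length_eq_dist u v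
  cases p with
  | nil => simp at h
  | cons hadj q =>
    rename_i w
    refine ⟨w, hadj, ?_⟩
    have h1 := dist_le q
    have h2 := hG.dist_triangle (u := u) (v := w) (w := v)
    rw [dist_eq_one_iff_adj.2 hadj] at h2
    rw [Walk.length_cons] at hp
    omega

theorem exists_common_adj (hG : G.Connected) {u v : V} (h : G.dist u v = 2) :
    ∃ w, G.Adj w u ∧ G.Adj w v := by
  obtain ⟨w, h1, h2⟩ := exists_adj_dist_eq hG h
  exact ⟨w, h1.symm, dist_eq_one_iff_adj.1 h2⟩

theorem exists_path_of_dist_eq_three (hG : G.Connected) {u v : V} (h : G.dist u v = 3) :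
    ∃ s t, G.Adj s u ∧ G.Adj s t ∧ G.Adj t v ∧ ¬ G.Adj s v ∧ ¬ G.Adj t u := by
  obtain ⟨s, h1, h2⟩ := exists_adj_dist_eq hG h
  obtain ⟨t, h3, h4⟩ := exists_adj_dist_eq hG h2
  refine ⟨s, t, h1.symm, h3, dist_eq_one_iff_adj.1 h4, fun hsv => ?_, fun htu => ?_⟩
  · rw [dist_eq_one_iff_adj.2 hsv] at h2; omega
  · have := hG.dist_triangle (u := u) (v := t) (w := v)
    rw [dist_eq_one_iff_adj.2 htu.symm, h4] at this
    omega

theorem dist_ge_two (hG : G.Connected) {u v : V} (hne : u ≠ v) (h : ¬ G.Adj u v) :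
    2 ≤ G.dist u v := by
  have h0 : G.dist u v ≠ 0 := fun h0 => hne (hG.dist_eq_zero_iff.1 h0)
  have h1 : G.dist u v ≠ 1 := fun h1 => h (dist_eq_one_iff_adj.1 h1)
  omega

theorem dist_eq_two (hG : G.Connected) {u v w : V} (hne : u ≠ v) (h : ¬ G.Adj u v)
    (hu : G.Adj u w) (hv : G.Adj w v) : G.dist u v = 2 := by
  have := dist_ge_two hG hne h
  have := hG.dist_triangle (u := u) (v := w) (w := v)
  rw [dist_eq_one_iff_adj.2 hu, dist_eq_one_iff_adj.2 hv] at this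
  omega

end Walks

/-! ### The two graphs whose exclusion depends on exact ambient distances. -/

namespace IsRankTwoCompletion

variable {V K : Type*} [Field K] {G : SimpleGraph V} {M : V → V → K}

theorem coreFree (h : IsRankTwoCompletion G M) (hG : G.Connected) : CoreFree G where
  bull := h.not_bull hG
  dart := h.not_dart hG
  house := h.not_house hG
  gem := h.not_gem hG
  fullHouse := h.not_fullHouse hG
  G65 := h.not_G65 hG
  fivePan := h.not_fivePan hG
  G68 := h.not_G68 hG
  G69 := h.not_G69 hG
  G610 := h.not_G610 hG
  G612 := h.not_G612 hG
  coTwinC5 := h.not_coTwinC5 hG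
  G614 := h.not_G614 hG
  G615 := h.not_G615 hG

theorem not_G67 (h : IsRankTwoCompletion G M) (hG : G.Connected) (h7 : ¬ cycleGraph 7 ⊴ G) :
    ¬ G67 ⊴ G := by
  rintro ⟨f⟩
  have hF := h.coreFree hG
  obtain ⟨p, hp⟩ := CharP.exists K
  have h04 := dist_map_eq_one f (i := 0) (j := 4) (by simp [G67])
  have h03 := dist_map_eq_two hG f (i := 0) (j := 3) 4 (by simp [G67])
  have h12 := dist_map_eq_one f (i := 1) (j := 2) (by simp [G67])
  have h15 := dist_map_eq_one f (i := 1) (j := 5) (by simp [G67])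
  have h25 := dist_map_eq_one f (i := 2) (j := 5) (by simp [G67])
  have h13 := dist_map_eq_two hG f (i := 1) (j := 3) 5 (by simp [G67])
  have h32 := dist_map_eq_two hG f (i := 3) (j := 2) 5 (by simp [G67])
  have h34 := dist_map_eq_one f (i := 3) (j := 4) (by simp [G67])
  have h43 := dist_map_eq_one f (i := 4) (j := 3) (by simp [G67])
  have h35 := dist_map_eq_one f (i := 3) (j := 5) (by simp [G67])
  have h45 := dist_map_eq_two hG f (i := 4) (j := 5) 3 (by simp [G67])
  have h14 : G.dist (f 1) (f 4) = 3 := by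
    rcases dist_map_eq_two_or_three hG f (i := 1) (j := 4) 5 3 (by simp [G67]) with hd | hd
    · obtain ⟨u, h1, h2⟩ := exists_common_adj hG hd
      exact (no_G67_extension_one_four hF (f 0) (f 1) (f 2) (f 3) (f 4) (f 5) u (by
          simp only [f.map_adj_iff, h1, h2, true_and]; simp [G67])).elim
    · exact hd
  have h42 : G.dist (f 4) (f 2) = 3 := by
    rcases dist_map_eq_two_or_three hG f (i := 4) (j := 2) 3 5 (by simp [G67]) with hd | hd
    · obtain ⟨u, h1, h2⟩ := exists_common_adj hG hd
      exact (no_G67_extension_one_four hF (f 0) (f 2) (f 1) (f 3) (f 4) (f 5) u (by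
          simp only [f.map_adj_iff, h1, h2, true_and]; simp [G67])).elim
    · exact hd
  have h05 : G.dist (f 0) (f 5) = 3 := by
    rcases dist_map_eq_two_or_three hG f (i := 0) (j := 5) 4 3 (by simp [G67]) with hd | hd
    · obtain ⟨u, h1, h2⟩ := exists_common_adj hG hd
      exact (no_G67_extension_zero_five hF (f 0) (f 1) (f 2) (f 3) (f 4) (f 5) u (by
          simp only [f.map_adj_iff, h1, h2, true_and]; simp [G67])).elim
    · exact hd
  have h02 : G.dist (f 0) (f 2) = 2 ∨ G.dist (f 0) (f 2) = 4 := by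
    have h1 := dist_map_ge_two hG f (i := 0) (j := 2) (by decide) (by simp [G67])
    have h2 := hG.dist_triangle (u := f 0) (v := f 5) (w := f 2)
    have h52 := dist_map_eq_one f (i := 5) (j := 2) (by simp [G67])
    -- With `d` for this distance, the minors below are `2d - 14` and `3d - 13`. They are coprime
    -- for `d = 2` and `d = 4`, but equal `-8` and `-4` for `d = 3`.
    have h3 : G.dist (f 0) (f 2) ≠ 3 := by
      intro hd
      obtain ⟨s, t, h1, h2, h3, h4, h5⟩ := exists_path_of_dist_eq_three hG hd
      exact (no_G67_path_extension hF h7 (f 0) (f 2) (f 1) (f 3) (f 4) (f 5) s t (by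
          simp only [f.map_adj_iff, h1, h2, h3, h4, h5, true_and]; simp [G67])).elim
    omega
  have m0 := h.charP_dvd_minor3 p f (a := 0) (b := 1) (c := 3) (d := 2) (e := 4) (k := 5)
    (by decide)
  have m1 := h.charP_dvd_minor3 p f (a := 0) (b := 1) (c := 4) (d := 2) (e := 3) (k := 5)
    (by decide)
  simp only [minor3, h04, h03, h12, h15, h13, h32, h34, h43, h35, h45, h14, h42, h05] at m0 m1
  rcases h02 with h02 | h02 <;> exact false_of_charP_dvd K m0 m1 (by norm_num [h02])

theorem not_coTwinHouse (h : IsRankTwoCompletion G M) (hG : G.Connected)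
    (h7 : ¬ cycleGraph 7 ⊴ G) : ¬ coTwinHouse ⊴ G := by
  rintro ⟨f⟩
  have hF := h.coreFree hG
  have h67 := h.not_G67 hG h7
  obtain ⟨p, hp⟩ := CharP.exists K
  have h03 := dist_map_eq_two hG f (i := 0) (j := 3) 5 (by simp [coTwinHouse])
  have h05 := dist_map_eq_one f (i := 0) (j := 5) (by simp [coTwinHouse])
  have h21 := dist_map_eq_two hG f (i := 2) (j := 1) 4 (by simp [coTwinHouse])
  have h23 := dist_map_eq_one f (i := 2) (j := 3) (by simp [coTwinHouse])
  have h25 := dist_map_eq_one f (i := 2) (j := 5) (by simp [coTwinHouse])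
  have h41 := dist_map_eq_one f (i := 4) (j := 1) (by simp [coTwinHouse])
  have h43 := dist_map_eq_one f (i := 4) (j := 3) (by simp [coTwinHouse])
  have h45 := dist_map_eq_two hG f (i := 4) (j := 5) 2 (by simp [coTwinHouse])
  -- With `d` for this distance, the minor used below is `d - 5`, a unit for `d = 4` but not for `d
  -- = 2` or `d = 3`.
  have h01 : G.dist (f 0) (f 1) = 4 := by
    have h1 := dist_map_ge_two hG f (i := 0) (j := 1) (by decide) (by simp [coTwinHouse])
    have h2 : G.dist (f 0) (f 1) ≠ 2 := by
      intro hd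
      obtain ⟨u, h1, h2⟩ := exists_common_adj hG hd
      exact (no_coTwinHouse_extension_zero_one hF h67 (f 0) (f 1) (f 2) (f 3) (f 4) (f 5) u (by
          simp only [f.map_adj_iff, h1, h2, true_and]; simp [coTwinHouse])).elim
    have h3 : G.dist (f 0) (f 1) ≠ 3 := by
      intro hd
      obtain ⟨s, t, h1, h2, h3, h4, h5⟩ := exists_path_of_dist_eq_three hG hd
      exact (no_coTwinHouse_path_extension hF h67 h7 (f 0) (f 1) (f 2) (f 3) (f 4) (f 5) s t (by
          simp only [f.map_adj_iff, h1, h2, h3, h4, h5, true_and]; simp [coTwinHouse])).elim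
    have h4 := hG.dist_triangle (u := f 0) (v := f 2) (w := f 1)
    have h02 := dist_map_eq_two hG f (i := 0) (j := 2) 5 (by simp [coTwinHouse])
    omega
  have m0 := h.charP_dvd_minor3 p f (a := 0) (b := 2) (c := 4) (d := 1) (e := 3) (k := 5)
    (by decide)
  simp only [minor3, h01, h03, h05, h21, h23, h25, h41, h43, h45] at m0
  exact false_of_charP_dvd K m0 m0 (by norm_num)

/-! ### Induced paths on six vertices and long odd holes. -/

/-- The minors of the distance matrix of an induced path on six vertices, as functions of the
distances between its vertices in an ambient graph. -/
theorem gcd_pathGraph_six_minors : ∀ x ∈ Finset.Icc (2 : ℤ) 3, ∀ z ∈ Finset.Icc (2 : ℤ) 3,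
    ∀ r ∈ Finset.Icc (2 : ℤ) 3, ∀ y ∈ Finset.Icc (2 : ℤ) 4, ∀ s ∈ Finset.Icc (2 : ℤ) 4,
    ∀ t ∈ Finset.Icc (2 : ℤ) 5, t ≤ y + 1 → t ≤ s + 1 →
    Int.gcd (Int.gcd (minor3 (fun a b : Fin 3 => !![x, y, t; 2, z, s; 1, 2, r] a b) 0 1 2 0 1 2)
        (minor3 (fun a b : Fin 3 => !![2, y, t; 1, z, s; 1, 1, 2] a b) 0 1 2 0 1 2))
      (Int.gcd (minor3 (fun a b : Fin 3 => !![1, y, t; 1, 2, r; 2, 1, 2] a b) 0 1 2 0 1 2)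
        (minor3 (fun a b : Fin 3 => !![1, 2, t; 2, 1, 2; z, 2, 1] a b) 0 1 2 0 1 2)) ∣
      if x = 3 ∧ z = 3 ∧ r = 3 ∧ ¬ (y = 3 ∧ s = 3) then 4 else 1 := by
  decide +kernel

end IsRankTwoCompletion

/-- The window of six consecutive vertices of a cycle starting at `c`. -/
theorem exists_pathGraph_six_embedding {V : Type*} {G : SimpleGraph V} {k : ℕ} (hk : 7 ≤ k)
    {g : ℕ → V} (hg : ∀ m n, g m = g n ↔ m ≡ n [MOD k])
    (hadj : ∀ m n, G.Adj (g m) (g n) ↔ m + 1 ≡ n [MOD k] ∨ n + 1 ≡ m [MOD k]) (c : ℕ) :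
    ∃ f : pathGraph 6 ↪g G, ∀ i : Fin 6, f i = g (c + i) := by
  have key : ∀ i j : ℕ, i < 7 → j < 7 → (c + i ≡ c + j [MOD k] ↔ i = j) := fun i j hi hj =>
    ⟨fun h => (Nat.ModEq.add_left_cancel' c h).eq_of_lt_of_lt (by omega) (by omega),
      fun h => h ▸ rfl⟩
  refine ⟨⟨⟨fun i => g (c + i), fun i j hij => Fin.ext ?_⟩, fun {i j} => ?_⟩, fun i => rfl⟩
  · exact (key i j (by omega) (by omega)).1 ((hg _ _).1 hij)
  · change G.Adj (g (c + i)) (g (c + j)) ↔ _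
    rw [hadj, pathGraph_adj, add_assoc, add_assoc, key _ _ (by omega) (by omega),
      key _ _ (by omega) (by omega)]

namespace IsRankTwoCompletion

variable {V K : Type*} [Field K] {G : SimpleGraph V} {M : V → V → K}

/-- The characteristic divides four minors whose greatest common divisor is one, except for the
distances in the conclusion; there it divides 4, which forces characteristic 2. -/
theorem pathGraph_six (h : IsRankTwoCompletion G M) (hG : G.Connected) (f : pathGraph 6 ↪g G) :
    (2 : K) = 0 ∧ G.dist (f 0) (f 3) = 3 ∧ G.dist (f 1) (f 4) = 3 ∧ G.dist (f 2) (f 5) = 3 ∧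
      ¬ (G.dist (f 0) (f 4) = 3 ∧ G.dist (f 1) (f 5) = 3) := by
  obtain ⟨p, hp⟩ := CharP.exists K
  have h01 := dist_map_eq_one f (i := 0) (j := 1) (by simp [pathGraph_adj])
  have h12 := dist_map_eq_one f (i := 1) (j := 2) (by simp [pathGraph_adj])
  have h23 := dist_map_eq_one f (i := 2) (j := 3) (by simp [pathGraph_adj])
  have h34 := dist_map_eq_one f (i := 3) (j := 4) (by simp [pathGraph_adj])
  have h45 := dist_map_eq_one f (i := 4) (j := 5) (by simp [pathGraph_adj])
  have h02 := dist_map_eq_two hG f (i := 0) (j := 2) 1 (by simp [pathGraph_adj])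
  have h13 := dist_map_eq_two hG f (i := 1) (j := 3) 2 (by simp [pathGraph_adj])
  have h24 := dist_map_eq_two hG f (i := 2) (j := 4) 3 (by simp [pathGraph_adj])
  have h35 := dist_map_eq_two hG f (i := 3) (j := 5) 4 (by simp [pathGraph_adj])
  have h03 := dist_map_eq_two_or_three hG f (i := 0) (j := 3) 1 2 (by simp [pathGraph_adj])
  have h14 := dist_map_eq_two_or_three hG f (i := 1) (j := 4) 2 3 (by simp [pathGraph_adj])
  have h25 := dist_map_eq_two_or_three hG f (i := 2) (j := 5) 3 4 (by simp [pathGraph_adj])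
  have h04 := dist_map_ge_two hG f (i := 0) (j := 4) (by decide) (by simp [pathGraph_adj])
  have h15 := dist_map_ge_two hG f (i := 1) (j := 5) (by decide) (by simp [pathGraph_adj])
  have h05 := dist_map_ge_two hG f (i := 0) (j := 5) (by decide) (by simp [pathGraph_adj])
  have t04 := hG.dist_triangle (u := f 0) (v := f 3) (w := f 4)
  have t15 := hG.dist_triangle (u := f 1) (v := f 4) (w := f 5)
  have t05 := hG.dist_triangle (u := f 0) (v := f 4) (w := f 5)
  have t05' := hG.dist_triangle (u := f 0) (v := f 1) (w := f 5)
  have m0 := h.charP_dvd_minor3 p f (a := 0) (b := 1) (c := 2) (d := 3) (e := 4) (k := 5)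
    (by decide)
  have m1 := h.charP_dvd_minor3 p f (a := 0) (b := 1) (c := 3) (d := 2) (e := 4) (k := 5)
    (by decide)
  have m2 := h.charP_dvd_minor3 p f (a := 0) (b := 2) (c := 3) (d := 1) (e := 4) (k := 5)
    (by decide)
  have m3 := h.charP_dvd_minor3 p f (a := 0) (b := 3) (c := 4) (d := 1) (e := 2) (k := 5)
    (by decide)
  have key := gcd_pathGraph_six_minors (G.dist (f 0) (f 3)) (by simp; omega)
    (G.dist (f 1) (f 4)) (by simp; omega) (G.dist (f 2) (f 5)) (by simp; omega)
    (G.dist (f 0) (f 4)) (by simp; omega) (G.dist (f 1) (f 5)) (by simp; omega)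
    (G.dist (f 0) (f 5)) (by simp; omega) (by omega) (by omega)
  have hd := dvd_trans (Nat.dvd_gcd
    (Int.natCast_dvd_natCast.1 (Int.dvd_coe_gcd
      (by simpa [minor3, h13, h23, h24] using m0)
      (by simpa [minor3, h02, h12, G.dist_comm (u := f 3) (v := f 2), h23, h34, h35] using m1)))
    (Int.natCast_dvd_natCast.1 (Int.dvd_coe_gcd
      (by simpa [minor3, h01, h24, h34, h35, G.dist_comm (u := f 2) (v := f 1), h12,
        G.dist_comm (u := f 3) (v := f 1), h13] using m2)
      (by simpa [minor3, h01, h02, h35, h45, G.dist_comm (u := f 3) (v := f 1), h13,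
        G.dist_comm (u := f 3) (v := f 2), h23, G.dist_comm (u := f 4) (v := f 1),
        G.dist_comm (u := f 4) (v := f 2), h24] using m3)))) key
  split_ifs at hd with hc
  · have h4 : ((4 : ℕ) : K) = 0 := (CharP.cast_eq_zero_iff K p 4).2 hd
    refine ⟨mul_self_eq_zero.1 (by rw [← h4]; norm_num), ?_, ?_, ?_, ?_⟩ <;> omega
  · exact absurd (Nat.dvd_one.1 hd) (CharP.char_ne_one K p)

/-- Rows two steps apart on the cycle agree. Going around an odd cycle by steps of two reaches every
vertex, so the rows of `g 0` and `g 1` agree; in the column of `g 2` they have the entries 2 and 1,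
and `2 = 0`. -/
theorem not_cycleGraph_aux (h : IsRankTwoCompletion G M) (hG : G.Connected) {k : ℕ} (hk : 7 ≤ k)
    (hodd : Odd k) {g : ℕ → V} (hg : ∀ m n, g m = g n ↔ m ≡ n [MOD k])
    (hadj : ∀ m n, G.Adj (g m) (g n) ↔ m + 1 ≡ n [MOD k] ∨ n + 1 ≡ m [MOD k])
    (hfour : ∀ c, G.dist (g c) (g (c + 4)) ≠ 3) : False := by
  have hwin := exists_pathGraph_six_embedding hk hg hadj
  have row : ∀ c v, M (g c) v = M (g (c + 2)) v := by
    intro c v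
    obtain ⟨f, hf⟩ := hwin c
    obtain ⟨h2, h03, h14, -, -⟩ := h.pathGraph_six hG f
    have e03 := h.apply_eq_natCast f (by decide) h03
    have e14 := h.apply_eq_natCast f (by decide) h14
    have e13 := h.apply_eq_two hG f (i := 1) (j := 3) 2 (by simp [pathGraph_adj])
    have e24 := h.apply_eq_two hG f (i := 2) (j := 4) 3 (by simp [pathGraph_adj])
    have e23 := h.apply_eq_one f (i := 2) (j := 3) (by simp [pathGraph_adj])
    have e04 : M (f 0) (f 4) = 0 := by
      have h1 := dist_map_ge_two hG f (i := 0) (j := 4) (by decide) (by simp [pathGraph_adj])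
      have h3 : G.dist (f 0) (f 4) ≠ 3 := by rw [hf, hf]; exact hfour c
      have h4 := hG.dist_triangle (u := f 0) (v := f 3) (w := f 4)
      have h34 := dist_map_eq_one f (i := 3) (j := 4) (by simp [pathGraph_adj])
      have h24 : G.dist (f 0) (f 4) = 2 ∨ G.dist (f 0) (f 4) = 4 := by omega
      rcases h24 with h24 | h24 <;> rw [h.apply_eq_natCast f (by decide) h24]
      · exact_mod_cast h2
      · push_cast; linear_combination 2 * h2
    -- In characteristic 2 the first two columns are `(1, 0, 1)` and `(0, 1, 0)`, so the minor is
    -- the difference of the entries of `f 0` and `f 2` in column `v`, which may itself meet the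
    -- diagonal.
    have hm := h.minor_eq_zero (f 0) (f 1) (f 2) (f 3) (f 4) v
    simp only [minor3, e03, e14, e13, e24, e23, e04] at hm
    have e0 : f 0 = g c := hf 0
    have e2 : f 2 = g (c + 2) := hf 2
    rw [← e0, ← e2]
    push_cast at hm
    linear_combination hm + (3 * M (f 1) v - 5 * M (f 2) v) * h2
  have even : ∀ n v, M (g 0) v = M (g (2 * n)) v := by
    intro n v
    induction n with
    | zero => rfl
    | succ n ih => rw [ih, row]; rfl
  obtain ⟨m, rfl⟩ := hodd
  have h1 : g (2 * (m + 1)) = g 1 := (hg _ _).2 (by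
    rw [show 2 * (m + 1) = (2 * m + 1) + 1 by ring]; simp [Nat.ModEq])
  obtain ⟨f, hf⟩ := hwin 0
  have e := even (m + 1) (g 2)
  rw [h1] at e
  have f0 : f 0 = g 0 := hf 0
  have f1 : f 1 = g 1 := hf 1
  have f2 : f 2 = g 2 := hf 2
  rw [← f0, ← f1, ← f2, h.apply_eq_one f (i := 1) (j := 2) (by simp [pathGraph_adj]),
    h.apply_eq_two hG f (i := 0) (j := 2) 1 (by simp [pathGraph_adj]),
    (h.pathGraph_six hG f).1] at e
  exact zero_ne_one e

theorem not_cycleGraph_seven (h : IsRankTwoCompletion G M) (hG : G.Connected) :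
    ¬ cycleGraph 7 ⊴ G := by
  rintro ⟨f⟩
  have hwin : ∀ c : Fin 7, ∃ e : pathGraph 6 ↪g cycleGraph 7,
      ∀ i : Fin 6, e i = c + i.castSucc := by
    intro c
    refine ⟨⟨⟨fun i => c + i.castSucc, fun i j hij => by simpa using hij⟩, fun {i j} => ?_⟩,
      fun i => rfl⟩
    change (cycleGraph 7).Adj (c + i.castSucc) (c + j.castSucc) ↔ _
    rw [cycleGraph_adj, pathGraph_adj, add_sub_add_left_eq_sub, add_sub_add_left_eq_sub]
    revert i j
    decide
  obtain ⟨e, he⟩ := hwin 0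
  -- The window starting at 4 runs through `4, 5, 6, 0, 1, 2`. It forces distance three for the
  -- pairs `4, 0` and `5, 1`, which the window starting at 0 forbids to hold together.
  obtain ⟨e', he'⟩ := hwin 4
  obtain ⟨-, -, -, -, hn⟩ := h.pathGraph_six hG (f.comp e)
  obtain ⟨-, h1, h2, -, -⟩ := h.pathGraph_six hG (f.comp e')
  refine hn ⟨?_, ?_⟩
  · rw [G.dist_comm]
    simpa [he, he'] using h1
  · rw [G.dist_comm]
    simpa [he, he'] using h2

theorem not_cycleGraph (h : IsRankTwoCompletion G M) (hG : G.Connected) {k : ℕ} (hk : 7 ≤ k)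
    (hodd : Odd k) : ¬ cycleGraph k ⊴ G := by
  rintro ⟨f⟩
  have h7 := h.not_cycleGraph_seven hG
  have hF := h.coreFree hG
  have : NeZero k := ⟨by omega⟩
  let g : ℕ → V := fun n => f (Fin.ofNat k n)
  have hg : ∀ m n, g m = g n ↔ m ≡ n [MOD k] := fun m n => by
    simp [g, f.injective.eq_iff, Fin.ext_iff, Nat.ModEq]
  have hadj : ∀ m n, G.Adj (g m) (g n) ↔ m + 1 ≡ n [MOD k] ∨ n + 1 ≡ m [MOD k] := by
    intro m n
    obtain ⟨l, rfl⟩ : ∃ l, k = l + 2 := ⟨k - 2, by omega⟩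
    have key : ∀ a b : ℕ, Fin.ofNat (l + 2) b - Fin.ofNat (l + 2) a = 1 ↔ a + 1 ≡ b [MOD l + 2]
      := by
      intro a b
      rw [sub_eq_iff_eq_add, eq_comm, ← Fin.val_inj]
      simp [Fin.val_add, Nat.ModEq, add_comm]
    simp only [g]
    rw [f.map_adj_iff, cycleGraph_adj, key, key, or_comm]
  refine h.not_cycleGraph_aux hG hk hodd hg hadj fun c hc => ?_
  obtain ⟨e, he⟩ := exists_pathGraph_six_embedding hk hg hadj c
  have e0 : e 0 = g c := he 0
  have e4 : e 4 = g (c + 4) := he 4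
  rw [← e0, ← e4] at hc
  obtain ⟨s, t, h1, h2, h3, h4, h5⟩ := exists_path_of_dist_eq_three hG hc
  refine no_path_five_extension hF h7 (e 0) (e 1) (e 2) (e 3) (e 4) s t ?_
  simp only [e.map_adj_iff, h1, h2, h3, h4, h5, true_and]
  simp [pathGraph_adj]

theorem isFamilyFree (h : IsRankTwoCompletion G M) (hG : G.Connected) :
    IsFamilyFree (ForbiddenGraph.family ∪ ForbiddenGraph.oddHoles7) G := by
  have hF := h.coreFree hG
  have h7 := h.not_cycleGraph_seven hG
  rintro H (hH | ⟨k, hk, hodd, rfl⟩)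
  · simp only [family, Set.mem_insert_iff, Set.mem_singleton_iff] at hH
    rcases hH with rfl | rfl | rfl | rfl | rfl | rfl | rfl | rfl | rfl | rfl | rfl | rfl | rfl |
      rfl | rfl | rfl
    exacts [hF.bull, hF.dart, hF.house, hF.gem, hF.fullHouse, hF.G65, hF.fivePan,
      h.not_G67 hG h7, hF.G68, hF.G69, hF.G610, h.not_coTwinHouse hG h7, hF.G612, hF.coTwinC5,
      hF.G614, hF.G615]
  · exact h.not_cycleGraph hG hk hodd

end IsRankTwoCompletion

/-! ### Rank two distance matrices for the listed graphs. -/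

section Twins

variable {V : Type*} {G : SimpleGraph V}

theorem exists_adj_of_ne (hG : G.Connected) {u v : V} (h : u ≠ v) : ∃ w, G.Adj u w := by
  have := hG.pos_dist_of_ne h
  obtain ⟨w, hw, -⟩ := exists_adj_dist_eq hG (k := G.dist u v - 1) (u := u) (v := v) (by omega)
  exact ⟨w, hw⟩

/-- Two distinct nonadjacent vertices of a connected graph with the same neighbors are at
distance two. -/
theorem dist_eq_two_of_twins (hG : G.Connected) {u v : V} (hne : u ≠ v) (h : ¬ G.Adj u v)
    (htwin : ∀ w, G.Adj u w → G.Adj v w) : G.dist u v = 2 := by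
  obtain ⟨w, hw⟩ := exists_adj_of_ne hG hne
  exact dist_eq_two hG hne h hw (htwin w hw).symm

end Twins

section Blocks

variable {V : Type*} [DecidableEq V] {G : SimpleGraph V}

/-- A graph whose distances off the diagonal are given, in a field `K`, by a matrix of rank at most
`k` evaluated at a block assignment has a proper distance ideal of index `k + 1`. -/
theorem distanceIdeal_ne_top_of_blocks {K ι : Type*} [Field K] {k : ℕ} (c : V → ι)
    (T : ι → ι → K) (A : ι → Fin k → K) (B : Fin k → ι → K)
    (hT : ∀ i j, T i j = ∑ l, A i l * B l j)
    (hdist : ∀ u v, u ≠ v → (G.dist u v : K) = T (c u) (c v)) :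
    distanceIdeal ℤ G (k + 1) ≠ ⊤ := by
  -- The diagonal is free, so it is chosen to make the full matrix constant on blocks.
  refine distanceIdeal_ne_top_of_factorization (fun v => T (c v) (c v)) (fun u => A (c u))
    (fun l v => B l (c v)) fun u v => ?_
  rw [← hT]
  split_ifs with huv
  · rw [huv]
  · exact hdist u v huv

/-- Modulo 2 a distance only records whether the colors of its endpoints differ. -/
theorem distanceIdeal_three_ne_top_of_isBipartite (hG : G.Connected) (hb : G.IsBipartite) :
    distanceIdeal ℤ G 3 ≠ ⊤ := by
  obtain ⟨C⟩ := hb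
  let c : G.Coloring Bool := Coloring.mk (fun v => C v = 0) (fun {u v} huv => by
    have := C.valid huv
    simp only [ne_eq, decide_eq_decide]
    omega)
  refine distanceIdeal_ne_top_of_blocks (K := ZMod 2) c (fun i j => if i = j then 0 else 1)
    (fun i l => if (i = true ↔ l = 0) then 1 else 0)
    (fun l j => if (j = true ↔ l = 0) then 0 else 1) (by decide) fun u v _ => ?_
  obtain ⟨p, hp⟩ := hG.exists_walk_length_eq_dist u v
  rw [← hp]
  split_ifs with h
  · exact (ZMod.natCast_eq_zero_iff_even).2 ((c.even_length_iff_congr p).2 (by rw [h]))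
  · exact (ZMod.natCast_eq_one_iff_odd).2 ((c.odd_length_iff_not_congr p).2 (by
      cases hu : c u <;> cases hv : c v <;> simp_all))

/-- Modulo 2 the block matrix has zeros on the diagonal and ones elsewhere; its three rows sum to
zero. -/
theorem distanceIdeal_three_ne_top_of_tripartite (hG : G.Connected) (c : V → Fin 3)
    (hc : ∀ u v, G.Adj u v ↔ c u ≠ c v) : distanceIdeal ℤ G 3 ≠ ⊤ := by
  refine distanceIdeal_ne_top_of_blocks (K := ZMod 2) c (fun i j => if i = j then 0 else 1)
    ![![1, 0], ![0, 1], ![1, 1]] ![![0, 1, 1], ![1, 0, 1]] (by decide) fun u v huv => ?_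
  split_ifs with h
  · rw [dist_eq_two_of_twins hG huv (fun hadj => (hc u v).1 hadj h)
      fun w hw => (hc v w).2 (h ▸ (hc u w).1 hw)]
    rfl
  · rw [dist_eq_one_iff_adj.2 ((hc u v).2 h), Nat.cast_one]

theorem distanceIdeal_three_ne_top_of_independent (hG : G.Connected) (L : V → Prop)
    (hL : ∀ u v, G.Adj u v ↔ u ≠ v ∧ ¬ (L u ∧ L v)) : distanceIdeal ℤ G 3 ≠ ⊤ := by
  classical
  refine distanceIdeal_ne_top_of_blocks (K := ZMod 2) (fun v => decide (L v))
    (fun i j => if i = true ∧ j = true then 0 else 1)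
    (fun i l => if l = 0 then 1 else if i = true then 1 else 0)
    (fun l j => if l = 0 then 1 else if j = true then 1 else 0) (by decide) fun u v huv => ?_
  simp only [decide_eq_true_eq]
  split_ifs with h
  · rw [dist_eq_two_of_twins hG huv (fun hadj => ((hL u v).1 hadj).2 h) fun w hw => (hL v w).2 ?_]
    · rfl
    · have := (hL u w).1 hw
      refine ⟨fun hvw => this.2 ⟨h.1, hvw ▸ h.2⟩, fun hvw => this.2 ⟨h.1, hvw.2⟩⟩
  · rw [dist_eq_one_iff_adj.2 ((hL u v).2 ⟨huv, h⟩), Nat.cast_one]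

theorem distanceIdeal_three_ne_top_of_cycleGraph_five (hG : G.Connected)
    (e : G ≃g cycleGraph 5) : distanceIdeal ℤ G 3 ≠ ⊤ := by
  -- The circulant matrix with first row `5, 1, 2, 2, 1` has eigenvalues `5 + 2 + 4 = 11` and, twice
  -- each, `3 - t` with `t² + t = 1`. Modulo 11 the value `t = 3` is a root, so three eigenvalues
  -- vanish and the rank is two.
  have hT : ∀ i j : Fin 5, (if i = j then 5 else if (cycleGraph 5).Adj i j then 1 else 2
    : ZMod 11) =
      ∑ l, (![![1, 0], ![0, 1], ![10, 7], ![4, 4], ![7, 10]] : Fin 5 → Fin 2 → ZMod 11) i l *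
        (![![5, 1, 2, 2, 1], ![1, 5, 1, 2, 2]] : Fin 2 → Fin 5 → ZMod 11) l j := by
    decide
  have : Fact (Nat.Prime 11) := ⟨by norm_num⟩
  refine distanceIdeal_ne_top_of_blocks e _ _ _ hT fun u v huv => ?_
  change (G.dist u v : ZMod 11) =
    if e u = e v then 5 else if (cycleGraph 5).Adj (e u) (e v) then 1 else 2
  rw [if_neg (e.injective.ne huv)]
  by_cases h : G.Adj u v
  · rw [if_pos (e.map_adj_iff.2 h), dist_eq_one_iff_adj.2 h, Nat.cast_one]
  · rw [if_neg (mt e.map_adj_iff.1 h)]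
    have key : ∀ i j : Fin 5, i ≠ j → ¬ (cycleGraph 5).Adj i j →
        ∃ l, (cycleGraph 5).Adj i l ∧ (cycleGraph 5).Adj l j := by decide
    obtain ⟨l, h1, h2⟩ := key (e u) (e v) (e.injective.ne huv) (fun h' => h (e.map_adj_iff.1 h'))
    rw [dist_eq_two hG huv h (w := e.symm l) (by rw [← e.map_adj_iff]; simpa using h1)
      (by rw [← e.map_adj_iff]; simpa using h2)]
    rfl

end Blocks

/-! ### Distances in induced subgraphs of path blowups. -/

section PathBlowup

variable {V : Type*} {G : SimpleGraph V} {k : ℕ} {a : Fin k → ℤ} {c : V → Fin k}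

/-- `c` assigns to each vertex of `G` a vertex of the path on `k` vertices, in such a way that `G`
is an induced subgraph of a blowup of the path with the sign pattern `s` for cliques. -/
def IsPathBlocks (G : SimpleGraph V) (s : Fin k → Prop) (c : V → Fin k) : Prop :=
  ∀ u v, G.Adj u v ↔ (pathGraph k).Adj (c u) (c v) ∨ (c u = c v ∧ u ≠ v ∧ s (c u))

theorem eq_of_fst_eq_of_eq_zero {x y : Σ i : Fin k, Fin ((a i).natAbs + 1)} (h : x.1 = y.1)
    (h0 : a x.1 = 0) : x = y := by
  obtain ⟨i, x⟩ := x
  obtain ⟨j, y⟩ := y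
  obtain rfl : i = j := h
  have h1 : (a i).natAbs + 1 = 1 := by rw [h0]; rfl
  have hx := lt_of_lt_of_eq x.2 h1
  have hy := lt_of_lt_of_eq y.2 h1
  congr 1
  exact Fin.ext (by omega)

/-- A block with `a i = 0` is a single vertex and counts as a clique or as an independent set at
will, so one sign pattern covers all nonnegative parameters. -/
theorem isPathBlocks_of_embedding {s : Fin k → Prop} (h1 : ∀ i, 0 < a i → s i)
    (h2 : ∀ i, s i → 0 ≤ a i) (f : G ↪g pathBlowup a) :
    IsPathBlocks G s (fun v => (f v).1) := by
  intro u v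
  rw [← f.map_adj_iff, ← f.injective.ne_iff]
  refine or_congr_right ⟨fun h => ⟨h.1, h.2.1, h1 _ h.2.2⟩, fun h => ⟨h.1, h.2.1, ?_⟩⟩
  exact (h2 _ h.2.2).lt_of_ne fun h0 => h.2.1 (eq_of_fst_eq_of_eq_zero h.1 h0.symm)

variable {s : Fin k → Prop}

theorem IsPathBlocks.natAbs_le_length (hc : IsPathBlocks G s c) {u v : V} (p : G.Walk u v) :
    ((c u : ℤ) - c v).natAbs ≤ p.length := by
  induction p with
  | nil => simp
  | cons hadj p ih =>
    rename_i u v w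
    rw [Walk.length_cons]
    rcases (hc _ _).1 hadj with h | h
    · rw [pathGraph_adj] at h; omega
    · rw [h.1]; omega

/-- Connectedness leaves no empty block between two occupied ones. Distances between different
blocks are therefore those of the path, even in a proper induced subgraph of the blowup. -/
theorem IsPathBlocks.exists_succ (hc : IsPathBlocks G s c) (hG : G.Connected) {u v : V}
    (h : c u < c v) : ∃ w, (c w : ℕ) = c u + 1 := by
  obtain ⟨p⟩ := hG.preconnected u v
  obtain ⟨d, -, h1, h2⟩ := p.exists_boundary_dart {x | c x ≤ c u} (le_refl (c u)) (not_le.2 h)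
  simp only [Set.mem_ofPred_eq, not_le] at h1 h2
  refine ⟨d.snd, ?_⟩
  rcases (hc _ _).1 d.adj with h | h
  · rw [pathGraph_adj] at h; omega
  · rw [h.1] at h1; omega

theorem IsPathBlocks.dist_le (hc : IsPathBlocks G s c) (hG : G.Connected) (n : ℕ) :
    ∀ {u v : V}, (c v : ℕ) = c u + n + 1 → G.dist u v ≤ n + 1 := by
  induction n with
  | zero =>
    intro u v h
    exact (dist_eq_one_iff_adj.2 ((hc u v).2 (Or.inl (pathGraph_adj.2 (by omega))))).le
  | succ n ih =>
    intro u v h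
    obtain ⟨w, hw⟩ := hc.exists_succ hG (u := u) (v := v) (by rw [Fin.lt_def]; omega)
    have h1 := hG.dist_triangle (u := u) (v := w) (w := v)
    rw [dist_eq_one_iff_adj.2 ((hc u w).2 (Or.inl (pathGraph_adj.2 (by omega))))] at h1
    have h2 := ih (u := w) (v := v) (by omega)
    omega

theorem IsPathBlocks.dist_eq (hc : IsPathBlocks G s c) (hG : G.Connected) {u v : V}
    (h : c u ≠ c v) : G.dist u v = ((c u : ℤ) - c v).natAbs := by
  refine le_antisymm ?_ ?_
  · rcases lt_or_gt_of_ne h with h | h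
    · have := hc.dist_le hG (u := u) (v := v) (c v - c u - 1) (by omega)
      omega
    · have := hc.dist_le hG (u := v) (v := u) (c u - c v - 1) (by omega)
      rw [G.dist_comm]
      omega
  · obtain ⟨p, hp⟩ := hG.exists_walk_length_eq_dist u v
    exact hp ▸ hc.natAbs_le_length p

theorem IsPathBlocks.dist_eq_two (hc : IsPathBlocks G s c) (hG : G.Connected) {u v : V}
    (hne : u ≠ v) (h : c u = c v) (hs : ¬ s (c u)) : G.dist u v = 2 := by
  refine dist_eq_two_of_twins hG hne (fun hadj => ?_) fun w hw => ?_
  · rcases (hc u v).1 hadj with h' | h'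
    · exact h'.ne h
    · exact hs h'.2.2
  · rcases (hc u w).1 hw with h' | h'
    · exact (hc v w).2 (Or.inl (h ▸ h'))
    · exact absurd h'.2.2 hs

theorem IsPathBlocks.distanceIdeal_ne_top [DecidableEq V] [DecidablePred s]
    (hc : IsPathBlocks G s c) (hG : G.Connected) (p : ℕ) [Fact p.Prime] {m : ℕ}
    (A : Fin k → Fin m → ZMod p) (B : Fin m → Fin k → ZMod p)
    (hT : ∀ i j : Fin k, ((if i = j then if s i then 1 else 2 else ((i : ℤ) - j).natAbs : ℕ) :
      ZMod p) = ∑ l, A i l * B l j) :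
    distanceIdeal ℤ G (m + 1) ≠ ⊤ := by
  refine distanceIdeal_ne_top_of_blocks c _ A B hT fun u v huv => ?_
  congr 1
  split_ifs with h hs
  · exact dist_eq_one_iff_adj.2 ((hc u v).2 (Or.inr ⟨h, huv, hs⟩))
  · exact hc.dist_eq_two hG huv h hs
  · exact hc.dist_eq hG h

theorem IsPathBlocks.distanceIdeal_three_ne_top_five [DecidableEq V] {c : V → Fin 5}
    (hc : IsPathBlocks G (fun i => i = 1 ∨ i = 3) c) (hG : G.Connected) :
    distanceIdeal ℤ G 3 ≠ ⊤ :=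
  hc.distanceIdeal_ne_top hG 2 ![![1, 0], ![0, 1], ![1, 0], ![1, 1], ![1, 0]]
    ![![0, 1, 0, 1, 0], ![1, 1, 1, 0, 1]] (by decide)

theorem IsPathBlocks.distanceIdeal_three_ne_top_four [DecidableEq V] {c : V → Fin 4}
    (hc : IsPathBlocks G (fun i => i = 0 ∨ i = 3) c) (hG : G.Connected) :
    distanceIdeal ℤ G 3 ≠ ⊤ :=
  hc.distanceIdeal_ne_top hG 3 ![![1, 0], ![0, 1], ![0, 2], ![1, 2]]
    ![![1, 1, 2, 0], ![1, 2, 1, 2]] (by decide)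

end PathBlowup

theorem IsCompleteTripartite.distanceIdeal_three_ne_top {V : Type*} [DecidableEq V]
    {G : SimpleGraph V} (h : IsCompleteTripartite G) (hG : G.Connected) :
    distanceIdeal ℤ G 3 ≠ ⊤ := by
  obtain ⟨a, b, c, -, -, -, ⟨e⟩⟩ := h
  exact distanceIdeal_three_ne_top_of_tripartite hG (fun v => (e v).1) fun u v =>
    e.map_adj_iff.symm

theorem IsCompleteMultipartiteOneLarge.distanceIdeal_three_ne_top {V : Type*} [Fintype V]
    [DecidableEq V] {G : SimpleGraph V} (h : IsCompleteMultipartiteOneLarge G)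
    (hG : G.Connected) : distanceIdeal ℤ G 3 ≠ ⊤ := by
  obtain ⟨p, -, -, ⟨e⟩⟩ := h
  refine distanceIdeal_three_ne_top_of_independent hG (fun v => (e v).1.val = 0) fun u v => ?_
  rw [← e.map_adj_iff, ← e.injective.ne_iff]
  generalize e u = x
  generalize e v = y
  obtain ⟨i, x⟩ := x
  obtain ⟨j, y⟩ := y
  change i ≠ j ↔ _
  by_cases hij : i = j
  · subst hij
    simp only [ne_eq, not_true, false_iff, Sigma.mk.injEq, heq_eq_eq, true_and, and_self, not_and,
      not_not]
    intro hxy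
    by_contra hi
    have hx := lt_of_lt_of_eq x.2 (if_neg hi)
    have hy := lt_of_lt_of_eq y.2 (if_neg hi)
    exact hxy (Fin.ext (by omega))
  · simp only [ne_eq, hij, not_false_eq_true, Sigma.mk.injEq, false_and, true_and, true_iff]
    exact fun h => hij (Fin.ext (h.1.trans h.2.symm))

/-- The list of graphs in the classification of the connected graphs with at most two trivial
distance ideals. -/
def IsListed {V : Type*} [Fintype V] (G : SimpleGraph V) : Prop :=
  Nonempty (G ≃g cycleGraph 5) ∨ G.IsBipartite ∨ IsCompleteTripartite G ∨
    IsCompleteMultipartiteOneLarge G ∨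
    (∃ m₁ n₁ m₂ n₂ m₃ : ℕ, G.IsIndContained
      (pathBlowup ![-(m₁ : ℤ), (n₁ : ℤ), -(m₂ : ℤ), (n₂ : ℤ), -(m₃ : ℤ)])) ∨
    (∃ n₁ m₁ m₂ n₂ : ℕ, G.IsIndContained
      (pathBlowup ![(n₁ : ℤ), -(m₁ : ℤ), -(m₂ : ℤ), (n₂ : ℤ)]))

theorem IsListed.distanceIdeal_three_ne_top {V : Type*} [Fintype V] [DecidableEq V]
    {G : SimpleGraph V} (h : IsListed G) (hG : G.Connected) : distanceIdeal ℤ G 3 ≠ ⊤ := by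
  rcases h with ⟨⟨e⟩⟩ | h | h | h | ⟨m₁, n₁, m₂, n₂, m₃, ⟨f⟩⟩ | ⟨n₁, m₁, m₂, n₂, ⟨f⟩⟩
  · exact distanceIdeal_three_ne_top_of_cycleGraph_five hG e
  · exact distanceIdeal_three_ne_top_of_isBipartite hG h
  · exact h.distanceIdeal_three_ne_top hG
  · exact h.distanceIdeal_three_ne_top hG
  · refine (isPathBlocks_of_embedding ?_ ?_ f).distanceIdeal_three_ne_top_five hG
    · intro i hi; fin_cases i <;> simp_all <;> omega
    · intro i hi; rcases hi with rfl | rfl <;> simp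
  · refine (isPathBlocks_of_embedding ?_ ?_ f).distanceIdeal_three_ne_top_four hG
    · intro i hi; fin_cases i <;> simp_all <;> omega
    · intro i hi; rcases hi with rfl | rfl <;> simp

/-! ### Induced odd cycles in non-bipartite graphs. -/

section Basic

variable {V : Type*} {G : SimpleGraph V}

theorem forall_of_adj_closed (hG : G.Connected) {S : V → Prop} {u : V} (hu : S u)
    (h : ∀ x y, S x → G.Adj x y → S y) (v : V) : S v := by
  obtain ⟨p⟩ := hG.preconnected u v
  induction p with
  | nil => exact hu
  | cons hadj _ ih => exact ih (h _ _ hu hadj)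

theorem exists_walk_getVert {u v : V} (p : G.Walk u v) (i n : ℕ) (h : i + n ≤ p.length) :
    ∃ w : G.Walk (p.getVert i) (p.getVert (i + n)), w.length = n := by
  induction n with
  | zero => exact ⟨Walk.nil, rfl⟩
  | succ n ih =>
    obtain ⟨w, hw⟩ := ih (by omega)
    exact ⟨w.concat (p.adj_getVert_succ (i := i + n) (by omega)), by simp [hw]⟩

/-- A shortest odd closed walk is an induced cycle. -/
theorem exists_odd_cycleGraph_isIndContained (h : ¬ G.IsBipartite) :
    ∃ k, Odd k ∧ 3 ≤ k ∧ cycleGraph k ⊴ G := by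
  classical
  have hex : ∃ k, Odd k ∧ ∃ u, ∃ p : G.Walk u u, p.length = k := by
    by_contra hcon
    refine h (two_colorable_iff_forall_loop_even.2 fun u p => ?_)
    by_contra hp
    exact hcon ⟨p.length, Nat.not_even_iff_odd.1 hp, u, p, rfl⟩
  obtain ⟨hodd, u, p, hp⟩ := Nat.find_spec hex
  have hmin : ∀ x (q : G.Walk x x), Odd q.length → Nat.find hex ≤ q.length := fun x q hq =>
    Nat.find_min' hex ⟨hq, x, q, rfl⟩
  generalize Nat.find hex = k at *
  have hk : 3 ≤ k := by
    obtain ⟨m, rfl⟩ := hodd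
    rcases m with _ | m
    · exact (G.loopless.irrefl u (Walk.adj_of_length_eq_one hp)).elim
    · omega
  have hclose : p.getVert k = p.getVert 0 := by rw [← hp]; simp
  -- Two positions cut the closed walk into two arcs, exactly one of them odd. If the vertices
  -- coincide, the odd arc is a shorter odd closed walk. If they are adjacent, the edge closes the
  -- even arc to an odd walk, so that arc has at least `k - 1` edges and the positions are
  -- consecutive on the cycle.
  have hwalks : ∀ i j, i < j → j ≤ k →
      (∃ w : G.Walk (p.getVert i) (p.getVert j), w.length = j - i) ∧
      ∃ w : G.Walk (p.getVert j) (p.getVert i), w.length = k - (j - i) := by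
    intro i j hij hj
    obtain ⟨w1, h1⟩ := exists_walk_getVert p i (j - i) (by omega)
    obtain ⟨w2, h2⟩ := exists_walk_getVert p j (k - j) (by omega)
    obtain ⟨w3, h3⟩ := exists_walk_getVert p 0 i (by omega)
    refine ⟨⟨w1.copy rfl (by congr; omega), by simpa using h1⟩,
      ⟨(w2.copy rfl (by rw [← hclose]; congr; omega)).append (w3.copy rfl (by simp)), ?_⟩⟩
    simp [h2, h3]
    omega
  refine ⟨k, hodd, hk, isIndContained_of_forall_lt (fun i => p.getVert i) fun i j hij => ?_⟩
  have hij' : (i : ℕ) < j := hij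
  obtain ⟨⟨w1, h1⟩, ⟨w2, h2⟩⟩ := hwalks i j hij' j.2.le
  have hpar : Odd (j - i : ℕ) ∨ Odd (k - (j - i) : ℕ) := by
    rcases Nat.even_or_odd (j - i : ℕ) with he | ho
    · exact Or.inr (Nat.Odd.sub_even (by omega) hodd he)
    · exact Or.inl ho
  have hne : p.getVert i ≠ p.getVert j := by
    intro heq
    rcases hpar with ho | ho
    · have := hmin _ (w1.copy rfl heq.symm) (by simpa [h1] using ho)
      simp [h1] at this
      omega
    · have := hmin _ (w2.copy rfl heq) (by simpa [h2] using ho)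
      simp [h2] at this
      omega
  refine ⟨hne, ?_⟩
  have hv1 : ((j - i : Fin k) : ℕ) = j - i := Fin.sub_val_of_le hij.le
  have hv2 : ((i - j : Fin k) : ℕ) = k + i - j := Fin.coe_sub_iff_lt.2 hij
  rw [cycleGraph_adj', hv1, hv2]
  constructor
  · intro hadj
    rcases hpar with ho | ho
    · have := hmin _ (w2.concat hadj) (by
        rw [Walk.length_concat, h2]
        obtain ⟨x, hx⟩ := ho
        obtain ⟨y, hy⟩ := hodd
        exact ⟨y - x, by omega⟩)
      rw [Walk.length_concat, h2] at this
      omega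
    · have := hmin _ (w1.concat hadj.symm) (by
        rw [Walk.length_concat, h1]
        obtain ⟨x, hx⟩ := ho
        obtain ⟨y, hy⟩ := hodd
        exact ⟨y - x, by omega⟩)
      rw [Walk.length_concat, h1] at this
      omega
  · rintro (hd | hd)
    · have e1 : (j : ℕ) = k - 1 := by omega
      have e0 : (i : ℕ) = 0 := by omega
      have := p.adj_getVert_succ (i := k - 1) (by omega)
      rw [show k - 1 + 1 = k by omega, hclose] at this
      rw [e0, e1]
      exact this.symm
    · have := p.adj_getVert_succ (i := i) (by omega)
      rwa [show (i : ℕ) + 1 = j by omega] at this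

end Basic

/-! ### Recognizing the listed graphs from block descriptions. -/

section Isomorphisms

variable {V : Type*} [Fintype V] {G : SimpleGraph V}

theorem nonempty_iso_completeMultipartiteGraph {ι : Type*} [DecidableEq ι] (c : V → ι) (s : ι → ℕ)
    (hs : ∀ i, Fintype.card {v // c v = i} = s i) (hc : ∀ u v, G.Adj u v ↔ c u ≠ c v) :
    Nonempty (G ≃g completeMultipartiteGraph (fun i => Fin (s i))) :=
  ⟨⟨(Equiv.sigmaFiberEquiv c).symm.trans
    (Equiv.sigmaCongrRight fun i => Fintype.equivFinOfCardEq (hs i)), fun {u v} => (hc u v).symm⟩⟩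

theorem isCompleteTripartite_of_blocks (c : V → Fin 3) (hsurj : Function.Surjective c)
    (hc : ∀ u v, G.Adj u v ↔ c u ≠ c v) : IsCompleteTripartite G := by
  have hpos : ∀ i, 0 < Fintype.card {v // c v = i} := fun i =>
    Fintype.card_pos_iff.2 ((hsurj i).elim fun v hv => ⟨⟨v, hv⟩⟩)
  refine ⟨_, _, _, hpos 0, hpos 1, hpos 2,
    nonempty_iso_completeMultipartiteGraph c _ (fun i => ?_) hc⟩
  fin_cases i <;> rfl

theorem isCompleteMultipartiteOneLarge_of_independent (L : V → Prop) (hne : ∃ v, L v)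
    (hL : ∀ u v, G.Adj u v ↔ u ≠ v ∧ ¬ (L u ∧ L v)) : IsCompleteMultipartiteOneLarge G := by
  classical
  have hcard : Fintype.card {v // L v} + Fintype.card {v // ¬ L v} = Fintype.card V := by
    have := Fintype.card_subtype_compl L
    have := Fintype.card_subtype_le L
    omega
  have hpos : 0 < Fintype.card {v // L v} :=
    Fintype.card_pos_iff.2 (hne.elim fun v hv => ⟨⟨v, hv⟩⟩)
  let e := Fintype.equivFin {v // ¬ L v}
  let c : V → Fin (Fintype.card {v // ¬ L v} + 1) := fun v =>
    if h : L v then 0 else (e ⟨v, h⟩).succ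
  have c0 : ∀ v, L v → c v = 0 := fun v h => dif_pos h
  have c1 : ∀ v (h : ¬ L v), c v = (e ⟨v, h⟩).succ := fun v h => dif_neg h
  refine ⟨Fintype.card {v // ¬ L v} + 1, by omega, by omega,
    nonempty_iso_completeMultipartiteGraph c _ (fun i => ?_) fun u v => ?_⟩
  · cases i using Fin.cases with
    | zero =>
      rw [if_pos (by simp)]
      have : Fintype.card {v // c v = 0} = Fintype.card {v // L v} :=
        Fintype.card_congr (Equiv.subtypeEquivRight fun v =>
          ⟨fun h => not_not.1 fun hv => Fin.succ_ne_zero _ ((c1 v hv).symm.trans h), c0 v⟩)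
      omega
    | succ i =>
      rw [if_neg (by simp), Fintype.card_eq_one_iff]
      refine ⟨⟨e.symm i, by rw [c1 _ (e.symm i).2]; simp⟩, fun ⟨v, hv⟩ => Subtype.ext ?_⟩
      have hLv : ¬ L v := fun h => Fin.succ_ne_zero i (hv.symm.trans (c0 v h))
      rw [c1 v hLv, Fin.succ_inj] at hv
      simp [← hv]
  · rw [hL]
    by_cases hu : L u <;> by_cases hv : L v
    · simp [c0 u hu, c0 v hv, hu, hv]
    · simp only [c0 u hu, c1 v hv, hv, and_false, not_false_eq_true, and_true]
      exact ⟨fun _ => (Fin.succ_ne_zero _).symm, fun _ h => hv (h ▸ hu)⟩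
    · simp only [c0 v hv, c1 u hu, hu, false_and, not_false_eq_true, and_true]
      exact ⟨fun _ => Fin.succ_ne_zero _, fun _ h => hu (h ▸ hv)⟩
    · simp [c1 u hu, c1 v hv, hu]

theorem IsPathBlocks.isIndContained {k : ℕ} {s : Fin k → Prop} {c : V → Fin k} {a : Fin k → ℤ}
    (hc : IsPathBlocks G s c) (h1 : ∀ i, s i → 0 < a i) (h2 : ∀ i, ¬ s i → a i ≤ 0)
    (hN : ∀ i, Fintype.card V ≤ (a i).natAbs + 1) : G ⊴ pathBlowup a := by
  -- Every block has room for all vertices of `G`, so a global numbering supplies the position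
  -- inside the block.
  let e := Fintype.equivFin V
  have hne : ∀ u v : V, (⟨c u, Fin.castLE (hN (c u)) (e u)⟩ : Σ i, Fin ((a i).natAbs + 1)) =
      ⟨c v, Fin.castLE (hN (c v)) (e v)⟩ → u = v := by
    intro u v huv
    rw [Sigma.mk.injEq] at huv
    refine e.injective (Fin.ext ?_)
    have hval : ∀ i j : Fin k, ∀ (x : Fin ((a i).natAbs + 1)) (y : Fin ((a j).natAbs + 1)),
        i = j → x ≍ y → (x : ℕ) = y := by
      rintro i j x y rfl h; rw [eq_of_heq h]
    exact hval _ _ _ _ huv.1 huv.2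
  refine ⟨⟨⟨fun v => ⟨c v, Fin.castLE (hN (c v)) (e v)⟩, hne⟩, fun {u v} => ?_⟩⟩
  rw [hc]
  refine or_congr_right ⟨fun h => ⟨h.1, fun huv => h.2.1 (huv ▸ rfl), ?_⟩,
    fun h => ⟨h.1, fun huv => h.2.1 (hne _ _ huv), h1 _ h.2.2⟩⟩
  by_contra hs
  exact absurd h.2.2 (not_lt.2 (h2 _ hs))

omit [Fintype V] in
theorem nonempty_iso_cycleGraph_five (hG : G.Connected) (hF : CoreFree G) (h : cycleGraph 5 ⊴ G) :
    Nonempty (G ≃g cycleGraph 5) := by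
  obtain ⟨f⟩ := h
  have key : ∀ i : Fin 5, (cycleGraph 5).Adj i (i + 1) ∧ (cycleGraph 5).Adj (i + 1) (i + 2) ∧
      (cycleGraph 5).Adj (i + 2) (i + 3) ∧ (cycleGraph 5).Adj (i + 3) (i + 4) ∧
      (cycleGraph 5).Adj i (i + 4) ∧ ¬ (cycleGraph 5).Adj i (i + 2) ∧
      ¬ (cycleGraph 5).Adj i (i + 3) ∧ ¬ (cycleGraph 5).Adj (i + 1) (i + 3) ∧
      ¬ (cycleGraph 5).Adj (i + 1) (i + 4) ∧ ¬ (cycleGraph 5).Adj (i + 2) (i + 4) := by decide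
  -- A neighbor of the cycle outside it is impossible, so by connectedness the cycle is everything.
  have hsurj : ∀ v, v ∈ Set.range f := by
    refine forall_of_adj_closed hG ⟨0, rfl⟩ ?_
    rintro _ w ⟨i, rfl⟩ hw
    by_contra hr
    have hne : ∀ j, w ≠ f j := fun j hj => hr ⟨j, hj.symm⟩
    refine no_cycle_five_extension hF (f i) (f (i + 1)) (f (i + 2)) (f (i + 3)) (f (i + 4)) w
      (hne _) (hne _) ?_
    simp only [f.map_adj_iff, hw.symm, true_and]
    exact key i
  exact ⟨(⟨Equiv.ofBijective f ⟨f.injective, hsurj⟩, f.map_adj_iff⟩ : cycleGraph 5 ≃g G).symm⟩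

end Isomorphisms

/-! ### Wheels with four spokes, and triangles without such wheels. -/

section Wheels

variable {V : Type*} {G : SimpleGraph V}

/-- The vertices `v, a, b, p, q` induce a wheel with center `v` and rim `a p b q`. -/
def IsFourWheel (G : SimpleGraph V) (v a b p q : V) : Prop :=
  G.Adj v a ∧ G.Adj v b ∧ G.Adj v p ∧ G.Adj v q ∧ G.Adj a p ∧ G.Adj a q ∧ G.Adj b p ∧ G.Adj b q ∧
    ¬ G.Adj a b ∧ ¬ G.Adj p q ∧ a ≠ b ∧ p ≠ q

/-- The vertex `w` sees nothing of the wheel, or the same vertices as `v`, as `p`, or as `a`. -/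
def FourWheelType (G : SimpleGraph V) (v a b p q w : V) : Prop :=
  (¬ G.Adj w v ∧ ¬ G.Adj w a ∧ ¬ G.Adj w b ∧ ¬ G.Adj w p ∧ ¬ G.Adj w q) ∨
  (¬ G.Adj w v ∧ G.Adj w a ∧ G.Adj w b ∧ G.Adj w p ∧ G.Adj w q) ∨
  (G.Adj w v ∧ G.Adj w a ∧ G.Adj w b ∧ ¬ G.Adj w p ∧ ¬ G.Adj w q) ∨
  (G.Adj w v ∧ ¬ G.Adj w a ∧ ¬ G.Adj w b ∧ G.Adj w p ∧ G.Adj w q)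

theorem IsFourWheel.type (hF : CoreFree G) {v a b p q : V} (h : IsFourWheel G v a b p q)
    (w : V) : FourWheelType G v a b p q w := by
  obtain ⟨h1, h2, h3, h4, h5, h6, h7, h8, h9, h10, h11, h12⟩ := h
  unfold FourWheelType
  grind [
    G.adj_comm, dart_not_pattern hF.dart w a b v p, dart_not_pattern hF.dart w a b p v,
    dart_not_pattern hF.dart w p q v a, fullHouse_not_pattern hF.fullHouse a b w v p,
    fullHouse_not_pattern hF.fullHouse b a w v p, fullHouse_not_pattern hF.fullHouse p q w v a,
    gem_not_pattern hF.gem a w b v p, gem_not_pattern hF.gem a w b p v,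
    gem_not_pattern hF.gem b w a v p, gem_not_pattern hF.gem p w q v a,
    G614_not_pattern hF.G614 a b p q v w, dart_not_pattern hF.dart w a b v q,
    dart_not_pattern hF.dart w a b q v, dart_not_pattern hF.dart w p q v b,
    dart_not_pattern hF.dart w p q b v, fullHouse_not_pattern hF.fullHouse q p w v a,
    gem_not_pattern hF.gem a w b v q, gem_not_pattern hF.gem q w p v a]

end Wheels

section Triangles

variable {V : Type*} {G : SimpleGraph V}

/-- For twins `u`, `v` this makes the neighbors outside their twin class independent: adjacent `a`
and `b` would form a complete graph with them, while `z` and `y` witness that neither is a twin of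
`v`. -/
theorem false_of_adj_of_distinguished (hF : CoreFree G) {u v a b z y : V} (huv : G.Adj u v)
    (hua : G.Adj u a) (hub : G.Adj u b) (hva : G.Adj v a) (hvb : G.Adj v b) (hab : G.Adj a b)
    (hz : G.Adj z u ↔ G.Adj z v) (hy : G.Adj y u ↔ G.Adj y v)
    (haz : ¬ (G.Adj z a ↔ G.Adj z v)) (hby : ¬ (G.Adj y b ↔ G.Adj y v)) (hza : z ≠ a)
      (hyb : y ≠ b) : False := by
  grind (splits := 30) [
    G.adj_comm, fullHouse_not_pattern hF.fullHouse z u v a b,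
    fullHouse_not_pattern hF.fullHouse z a b u v, fullHouse_not_pattern hF.fullHouse y u v a b,
    fullHouse_not_pattern hF.fullHouse y a b u v, G614_not_pattern hF.G614 a z b y u v,
    bull_not_pattern hF.bull z y u b a, dart_not_pattern hF.dart z b y u a,
    dart_not_pattern hF.dart y a z u b, fullHouse_not_pattern hF.fullHouse z u v a y,
    fullHouse_not_pattern hF.fullHouse z a y u v, fullHouse_not_pattern hF.fullHouse y u v b z,
    house_not_pattern hF.house z y u b a]

/-- Outside vertices can single out at most one corner of a given triangle. -/
theorem false_of_separated (hF : CoreFree G) (hW : ∀ v a b p q, ¬ IsFourWheel G v a b p q)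
    {x y z p q : V} (hxy : G.Adj x y) (hxz : G.Adj x z) (hyz : G.Adj y z)
    (hp : ¬ (G.Adj p x ↔ G.Adj p y)) (hp' : G.Adj p y ↔ G.Adj p z)
    (hq : ¬ (G.Adj q x ↔ G.Adj q y)) (hq' : G.Adj q x ↔ G.Adj q z) (hpx : p ≠ x) (hqy : q ≠ y) :
    False := by
  have h1 := hW z p x y q
  clear hW
  unfold IsFourWheel at h1
  grind (splits := 30) [
    G.adj_comm, bull_not_pattern hF.bull p q z y x, house_not_pattern hF.house p q z y x,
    dart_not_pattern hF.dart p y q z x, gem_not_pattern hF.gem y p q z x,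
    dart_not_pattern hF.dart q x p z y, gem_not_pattern hF.gem x q p z y,
    gem_not_pattern hF.gem p q x y z]

/-- A vertex distinguishing two corners singles out one of the three. If every pair is
distinguished, at least two different corners are singled out, against `false_of_separated`. -/
theorem false_of_triangle_distinguished (hF : CoreFree G)
    (hW : ∀ v a b p q, ¬ IsFourWheel G v a b p q) {x y z p q r : V} (hxy : G.Adj x y)
    (hxz : G.Adj x z) (hyz : G.Adj y z) (hp : ¬ (G.Adj p x ↔ G.Adj p y))
    (hq : ¬ (G.Adj q x ↔ G.Adj q z)) (hr : ¬ (G.Adj r y ↔ G.Adj r z)) (hpx : p ≠ x) (hpy : p ≠ y)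
    (hqx : q ≠ x) (hqz : q ≠ z) (hry : r ≠ y) (hrz : r ≠ z) : False := by
  have h1 := @false_of_separated _ _ hF hW x y z
  have h2 := @false_of_separated _ _ hF hW x z y
  have h3 := @false_of_separated _ _ hF hW y z x
  by_cases hp' : G.Adj p y ↔ G.Adj p z <;> by_cases hq' : G.Adj q z ↔ G.Adj q y <;>
    by_cases hr' : G.Adj r z ↔ G.Adj r x <;> grind [G.adj_comm]

/-- If `b` misses `w`, the adjacencies of `a`, `x` and of `w`, `x` decide which forbidden graph
appears. Consequently a vertex of the first layer with some neighbor in the second layer sees all of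
it. -/
theorem adj_of_twins_chain (hF : CoreFree G) (hct : ¬ coTwinHouse ⊴ G) {u v a b w x : V}
    (huv : G.Adj u v) (hua : G.Adj u a) (hub : G.Adj u b) (hva : G.Adj v a) (hvb : G.Adj v b)
    (haw : G.Adj a w) (hbx : G.Adj b x) (hab : ¬ G.Adj a b) (huw : ¬ G.Adj u w)
    (hux : ¬ G.Adj u x) (hvw : ¬ G.Adj v w) (hvx : ¬ G.Adj v x) : G.Adj b w := by
  by_contra hbw
  grind (splits := 30) [
    G.adj_comm, G612_not_pattern hF.G612 w x u v b a, coTwinC5_not_pattern hF.coTwinC5 w x u v b a,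
    coTwinHouse_not_pattern hct w x u v b a, house_not_pattern hF.house u b w x a]

end Triangles

section Tripartite

variable {V : Type*} [Fintype V] {G : SimpleGraph V}

/-- A vertex with a neighbor in the wheel can replace a wheel vertex of its type, and the
classification then applies to the new wheel. This shows that no vertex is away from the wheel, and
that the types determine all adjacencies. -/
theorem IsFourWheel.isCompleteTripartite (hF : CoreFree G) (hG : G.Connected) {v a b p q : V}
    (h : IsFourWheel G v a b p q) : IsCompleteTripartite G := by
  classical
  have hT := h.type hF
  have hT0 : ∀ u, ¬ G.Adj u v → G.Adj u a → G.Adj u b → G.Adj u p → G.Adj u q →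
      ∀ w, FourWheelType G u a b p q w := by
    intro u h1 h2 h3 h4 h5
    exact IsFourWheel.type hF (by unfold IsFourWheel at *; grind)
  have hT1 : ∀ u, G.Adj u v → G.Adj u a → G.Adj u b → ¬ G.Adj u q → u ≠ q →
      ∀ w, FourWheelType G v a b u q w := by
    intro u h1 h2 h3 h4 h5
    exact IsFourWheel.type hF (by unfold IsFourWheel at *; grind [G.adj_comm])
  have hT2 : ∀ u, G.Adj u v → ¬ G.Adj u b → G.Adj u p → G.Adj u q → u ≠ b →
      ∀ w, FourWheelType G v u b p q w := by
    intro u h1 h2 h3 h4 h5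
    exact IsFourWheel.type hF (by unfold IsFourWheel at *; grind [G.adj_comm])
  have hN : ∀ w, G.Adj w v ∨ G.Adj w a ∨ G.Adj w b ∨ G.Adj w p ∨ G.Adj w q := by
    refine forall_of_adj_closed hG (u := v) (by unfold IsFourWheel at h; grind) ?_
    intro w x hw hwx
    by_contra hx
    have t := hT w
    have t0 := hT0 w
    have t1 := hT1 w
    have t2 := hT2 w
    clear hT0 hT1 hT2 hT
    unfold IsFourWheel at h
    rcases t with t | t | t | t
    · grind
    · have := t0 t.1 t.2.1 t.2.2.1 t.2.2.2.1 t.2.2.2.2 x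
      unfold FourWheelType at this
      grind [G.adj_comm]
    · have := t1 t.1 t.2.1 t.2.2.1 t.2.2.2.2 (by grind [G.adj_comm]) x
      unfold FourWheelType at this
      grind [G.adj_comm]
    · have := t2 t.1 t.2.2.1 t.2.2.2.1 t.2.2.2.2 (by grind [G.adj_comm]) x
      unfold FourWheelType at this
      grind [G.adj_comm]
  refine isCompleteTripartite_of_blocks
    (fun w => if G.Adj w v then if G.Adj w a then 1 else 2 else 0) ?_ ?_
  · unfold IsFourWheel at h
    intro i
    fin_cases i
    · exact ⟨v, by simp⟩
    · exact ⟨p, by simp [h.2.2.1.symm, h.2.2.2.2.1.symm]⟩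
    · exact ⟨a, by simp [h.1.symm]⟩
  · intro u w
    have hu := hT u
    have hw := hT w
    have nu := hN u
    have nw := hN w
    have t0 := hT0 u
    have t1 := hT1 u
    have t2 := hT2 u
    have s0 := hT0 w
    have s1 := hT1 w
    clear hT0 hT1 hT2 hT hN hF
    unfold FourWheelType at *
    rcases hu with hu | hu | hu | hu
    · grind
    · have := t0 hu.1 hu.2.1 hu.2.2.1 hu.2.2.2.1 hu.2.2.2.2 w
      clear t0 t1 t2 s0 s1
      grind [G.adj_comm]
    · have := t1 hu.1 hu.2.1 hu.2.2.1 hu.2.2.2.2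
      have h3 : w ≠ u → ¬ G.Adj w v → _ := fun _ h1 => s0 h1
      -- Putting `u` in the place of `p` requires `u ≠ q`; for `u = q` the original wheel suffices.
      -- The case `u = b` below is analogous.
      by_cases huq : u = q
      · subst huq
        clear t0 t1 t2 s0 s1
        grind [G.adj_comm]
      · have := this huq w
        clear t0 t1 t2 s0 s1
        grind [G.adj_comm]
    · have := t2 hu.1 hu.2.2.1 hu.2.2.2.1 hu.2.2.2.2
      by_cases hub : u = b
      · subst hub
        clear t0 t1 t2 s0 s1
        grind [G.adj_comm]
      · have := this hub w
        clear t0 t1 t2 s0 s1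
        grind [G.adj_comm]

end Tripartite

/-! ### Layers around a class of twins. -/

section Layers

variable {V : Type*} {G : SimpleGraph V}

/-- `x` and `y` have the same closed neighborhood. -/
def IsTwin (G : SimpleGraph V) (x y : V) : Prop :=
  ∀ w, (w = x ∨ G.Adj w x) ↔ (w = y ∨ G.Adj w y)

theorem IsTwin.adj {x y : V} (h : IsTwin G x y) (hne : x ≠ y) : G.Adj x y :=
  ((h x).1 (Or.inl rfl)).resolve_left hne

theorem exists_distinguished_of_not_isTwin {x y : V} (hxy : G.Adj x y) (h : ¬ IsTwin G x y) :
    ∃ p, p ≠ x ∧ p ≠ y ∧ ¬ (G.Adj p x ↔ G.Adj p y) := by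
  by_contra hc
  push Not at hc
  refine h fun w => ?_
  grind [G.adj_comm]

theorem exists_isTwin_of_triangle (hF : CoreFree G) (hW : ∀ v a b p q, ¬ IsFourWheel G v a b p q)
    {x y z : V} (hxy : G.Adj x y) (hxz : G.Adj x z) (hyz : G.Adj y z) :
    ∃ u v, u ≠ v ∧ IsTwin G u v := by
  by_contra! hc
  obtain ⟨p, p1, p2, hp⟩ := exists_distinguished_of_not_isTwin hxy (hc _ _ hxy.ne)
  obtain ⟨q, q1, q2, hq⟩ := exists_distinguished_of_not_isTwin hxz (hc _ _ hxz.ne)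
  obtain ⟨r, r1, r2, hr⟩ := exists_distinguished_of_not_isTwin hyz (hc _ _ hyz.ne)
  exact false_of_triangle_distinguished hF hW hxy hxz hyz hp hq hr p1 p2 q1 q2 r1 r2

/-- A covering of the graph by a clique `Q` of twins, its independent neighborhood `A`, and the
vertices `W` and `U` at distance two and three from `Q`. -/
structure TwinLayers (G : SimpleGraph V) (Q A W U : V → Prop) : Prop where
  cover : ∀ x, Q x ∨ A x ∨ W x ∨ U x
  exists_twins : ∃ u v, Q u ∧ Q v ∧ G.Adj u v
  adj_QQ : ∀ x y, Q x → Q y → x ≠ y → G.Adj x y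
  adj_QA : ∀ x y, Q x → A y → G.Adj x y
  not_adj_AA : ∀ x y, A x → A y → ¬ G.Adj x y
  not_adj_QW : ∀ x y, Q x → W y → ¬ G.Adj x y
  not_adj_QU : ∀ x y, Q x → U y → ¬ G.Adj x y
  not_adj_AU : ∀ x y, A x → U y → ¬ G.Adj x y
  exists_adj_W : ∀ x, W x → ∃ a, A a ∧ G.Adj a x
  exists_adj_U : ∀ x, U x → ∃ w, W w ∧ G.Adj w x
  adj_AW : ∀ a b w x, A a → A b → W w → W x → G.Adj a w → G.Adj b x → G.Adj b w
  adj_WU : ∀ w y, W w → U y → G.Adj w y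

theorem IsTwin.exists_twinLayers (hF : CoreFree G) (h67 : ¬ G67 ⊴ G) (hct : ¬ coTwinHouse ⊴ G)
    (hG : G.Connected) {u v : V} (huv : u ≠ v) (h : IsTwin G u v) :
    ∃ Q A W U, TwinLayers G Q A W U := by
  have hadj := h.adj huv
  let Q : V → Prop := fun x => IsTwin G x v
  let A : V → Prop := fun x => G.Adj x v ∧ ¬ IsTwin G x v
  let W : V → Prop := fun x => x ≠ v ∧ ¬ G.Adj x v ∧ ∃ a, A a ∧ G.Adj a x
  let U : V → Prop := fun x => x ≠ v ∧ ¬ G.Adj x v ∧ ¬ W x ∧ ∃ w, W w ∧ G.Adj w x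
  have hQv : Q v := fun w => Iff.rfl
  have hQ : ∀ x, Q x → ∀ w, G.Adj x w ↔ w ≠ x ∧ (w = v ∨ G.Adj w v) := by
    intro x hx w
    have := hx w
    have := hx x
    grind [G.adj_comm, Adj.ne]
  have huw : ∀ w, w ≠ u → w ≠ v → (G.Adj w u ↔ G.Adj w v) := by
    intro w; have := h w; grind
  have hW : ∀ x, W x → x ≠ v ∧ ¬ G.Adj x v ∧ ¬ G.Adj x u := by
    intro x hx; have := hx.1; have := hx.2.1; have := huw x; grind [G.adj_comm]
  have hU : ∀ x, U x → x ≠ v ∧ ¬ G.Adj x v ∧ ¬ G.Adj x u ∧ ∀ a, A a → ¬ G.Adj a x := by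
    intro x hx
    have h1 := hx.1; have h2 := hx.2.1; have h3 := huw x
    refine ⟨h1, h2, by grind [G.adj_comm], fun a ha hax => hx.2.2.1 ⟨h1, h2, a, ha, hax⟩⟩
  have hA : ∀ a, A a → G.Adj a v ∧ G.Adj a u := by
    intro a ha
    have h1 : a ≠ u := by rintro rfl; exact ha.2 h
    have := huw a h1 ha.1.ne
    exact ⟨ha.1, this.2 ha.1⟩
  have hAA : ∀ x y, A x → A y → ¬ G.Adj x y := by
    intro a b ha hb hab
    obtain ⟨z, z1, z2, hz⟩ := exists_distinguished_of_not_isTwin ha.1 ha.2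
    obtain ⟨y, y1, y2, hy⟩ := exists_distinguished_of_not_isTwin hb.1 hb.2
    have h1 := hA a ha
    have h2 := hA b hb
    refine false_of_adj_of_distinguished hF hadj h1.2.symm h2.2.symm h1.1.symm h2.1.symm hab
      (huw z ?_ z2) (huw y ?_ y2) hz hy z1 y1
    · rintro rfl; exact hz ⟨fun _ => hadj, fun _ => h1.2.symm⟩
    · rintro rfl; exact hy ⟨fun _ => hadj, fun _ => h2.2.symm⟩
  have hAW : ∀ a b w x, A a → A b → W w → W x → G.Adj a w → G.Adj b x → G.Adj b w := by
    intro a b w x ha hb hw hx haw hbx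
    exact adj_of_twins_chain hF hct hadj (hA a ha).2.symm (hA b hb).2.symm (hA a ha).1.symm
      (hA b hb).1.symm haw hbx (hAA a b ha hb) (fun h => (hW w hw).2.2 h.symm)
      (fun h => (hW x hx).2.2 h.symm) (fun h => (hW w hw).2.1 h.symm)
      (fun h => (hW x hx).2.1 h.symm)
  -- A vertex one layer beyond `U` would give a path of three edges attached to the triangle `u v
  -- a`, that is, `G67`.
  have hfar : ∀ x, x = v ∨ G.Adj x v ∨ W x ∨ U x := by
    refine forall_of_adj_closed hG (u := v) (Or.inl rfl) ?_
    intro x y hx hxy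
    by_contra! hy
    obtain ⟨y1, y2, y3, y4⟩ := hy
    have hxW : ¬ W x := fun hx => y4 ⟨y1, y2, y3, x, hx, hxy⟩
    have hxA : ¬ A x := fun hx => y3 ⟨y1, y2, x, hx, hxy⟩
    have hxQ : ¬ Q x := fun hx => by
      have := (hQ x hx y).1 hxy
      grind
    have hxU : U x := by
      rcases hx with rfl | hx | hx | hx
      · exact absurd hQv hxQ
      · exact absurd ⟨hx, hxQ⟩ hxA
      · exact absurd hx hxW
      · exact hx
    obtain ⟨-, -, -, w, hw, hwx⟩ := id hxU
    obtain ⟨-, -, a, ha, haw⟩ := id hw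
    have hyu : ¬ G.Adj y u := by
      have := huw y; have := (hU x hxU).2.2.1; grind [G.adj_comm]
    have hyw : ¬ G.Adj y w := fun h => y4 ⟨y1, y2, y3, w, hw, h.symm⟩
    have hya : ¬ G.Adj y a := fun h => y3 ⟨y1, y2, a, ha, h.symm⟩
    have h1 := hA a ha
    have h2 := hW w hw
    have h3 := hU x hxU
    have h4 := h3.2.2.2 a ha
    have := G67_not_pattern h67 y u v w x a
    clear hQ huw hW hU hA hAA hAW
    grind [G.adj_comm]
  refine ⟨Q, A, W, U, ?_, ⟨u, v, h, hQv, hadj⟩, ?_, ?_, hAA, ?_, ?_, ?_, fun x hx => hx.2.2,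
    fun x hx => hx.2.2.2, hAW, ?_⟩
  · intro x
    rcases hfar x with rfl | hx | hx | hx
    · exact Or.inl hQv
    · by_cases hq : Q x
      · exact Or.inl hq
      · exact Or.inr (Or.inl ⟨hx, hq⟩)
    · exact Or.inr (Or.inr (Or.inl hx))
    · exact Or.inr (Or.inr (Or.inr hx))
  · intro x y hx hy hne
    refine (hQ x hx y).2 ⟨hne.symm, ?_⟩
    exact (hy y).1 (Or.inl rfl)
  · intro x y hx hy
    refine (hQ x hx y).2 ⟨?_, Or.inr hy.1⟩
    rintro rfl; exact hy.2 hx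
  · intro x y hx hy hxy
    have := (hQ x hx y).1 hxy
    have := hW y hy
    grind
  · intro x y hx hy hxy
    have := (hQ x hx y).1 hxy
    have := hU y hy
    grind
  · intro x y hx hy
    exact (hU y hy).2.2.2 x hx
  · intro w' y hw' hy
    obtain ⟨-, -, -, w, hw, hwy⟩ := id hy
    obtain ⟨-, -, a, ha, haw⟩ := id hw
    obtain ⟨-, -, b, hb, hbw⟩ := id hw'
    have haw' := hAW b a w' w hb ha hw' hw hbw haw
    have h1 := hA a ha
    have h2 := hW w hw
    have h3 := hU y hy
    have h4 := h3.2.2.2 a ha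
    have h5 := hW w' hw'
    have := bull_not_pattern hF.bull v y w' w a
    have := G65_not_pattern hF.G65 y w' u v w a
    clear hQ huw hW hU hA hAA hAW hfar
    grind [G.adj_comm]

end Layers

/-! ### Uniform layers and assembly into path blowups. -/

section Cographs

variable {V : Type*} {G : SimpleGraph V}

/-- Without induced paths on three vertices a graph is a disjoint union of cliques; if also no
vertex misses both ends of an edge, a single edge forces a single clique. Hence such a layer is a
clique or independent. -/
theorem adj_of_edge {S : V → Prop} (hP : ∀ x y z, S x → S y → S z → G.Adj x y → G.Adj y z →
      x ≠ z → G.Adj x z)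
    (hK : ∀ x y z, S x → S y → S z → G.Adj x y → ¬ G.Adj z x → ¬ G.Adj z y → z = x ∨ z = y)
    {p q : V} (hp : S p) (hq : S q) (hpq : G.Adj p q) (x y : V) (hx : S x) (hy : S y)
    (hxy : x ≠ y) : G.Adj x y := by
  have h : ∀ x, S x → x ≠ p → G.Adj x p := by
    intro x hx hxp
    by_contra hc
    rcases hK p q x hp hq hx hpq hc (fun h => hc (hP x q p hx hq hp h hpq.symm hxp)) with rfl | rfl
    · exact hxp rfl
    · exact hc hpq.symm
  rcases eq_or_ne y p with rfl | hyp
  · exact h x hx hxy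
  rcases eq_or_ne x p with rfl | hxp
  · exact (h y hy hyp).symm
  exact hP x p y hx hp hy (h x hx hxp) (h y hy hyp).symm hxy

theorem exists_isPathBlocks {k : ℕ} {s : Fin k → Prop} (P : Fin k → V → Prop)
    (hP : ∀ x, ∃ i, P i x)
    (h : ∀ i j, i ≤ j → ∀ x y, P i x → P j y →
      (G.Adj x y ↔ (pathGraph k).Adj i j ∨ (i = j ∧ x ≠ y ∧ s i))) :
    ∃ c, IsPathBlocks G s c := by
  choose c hc using hP
  refine ⟨c, fun x y => ?_⟩
  rcases le_total (c x) (c y) with hle | hle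
  · exact h _ _ hle x y (hc x) (hc y)
  · rw [G.adj_comm, h _ _ hle y x (hc y) (hc x), (pathGraph k).adj_comm]
    grind

end Cographs

namespace TwinLayers

variable {V : Type*} {G : SimpleGraph V} {Q A W U : V → Prop}

theorem adj_W_of_edge (hF : CoreFree G) (h : TwinLayers G Q A W U) {w w' : V} (hw : W w)
    (hw' : W w') (hww : G.Adj w w') (x y : V) : W x → W y → x ≠ y → G.Adj x y := by
  obtain ⟨u, v, hu, hv, huv⟩ := h.exists_twins
  obtain ⟨a, ha, haw⟩ := h.exists_adj_W w hw
  have haW : ∀ x, W x → G.Adj a x := fun x hx => by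
    obtain ⟨b, hb, hbx⟩ := h.exists_adj_W x hx
    exact h.adj_AW b a x w hb ha hx hw hbx haw
  have hua := h.adj_QA u a hu ha
  have hva := h.adj_QA v a hv ha
  refine adj_of_edge (S := W) ?_ ?_ hw hw' hww x y
  · intro x y z hx hy hz
    have := dart_not_pattern hF.dart v x z y a
    have := haW x hx; have := haW y hy; have := haW z hz
    have := h.not_adj_QW v x hv hx; have := h.not_adj_QW v y hv hy
    have := h.not_adj_QW v z hv hz
    grind [G.adj_comm]
  · intro x y z hx hy hz
    have := G68_not_pattern hF.G68 z u x y v a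
    have := haW x hx; have := haW y hy; have := haW z hz
    have := h.not_adj_QW v x hv hx; have := h.not_adj_QW v y hv hy
    have := h.not_adj_QW v z hv hz
    have := h.not_adj_QW u x hu hx; have := h.not_adj_QW u y hu hy
    have := h.not_adj_QW u z hu hz
    grind [G.adj_comm]

theorem adj_U_of_edge (hF : CoreFree G) (h : TwinLayers G Q A W U) {y y' : V} (hy : U y)
    (hy' : U y') (hyy : G.Adj y y') (x z : V) : U x → U z → x ≠ z → G.Adj x z := by
  obtain ⟨u, v, hu, hv, huv⟩ := h.exists_twins
  obtain ⟨w, hw, -⟩ := h.exists_adj_U y hy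
  obtain ⟨a, ha, haw⟩ := h.exists_adj_W w hw
  have hva := h.adj_QA v a hv ha
  have hvw := h.not_adj_QW v w hv hw
  refine adj_of_edge (S := U) ?_ ?_ hy hy' hyy x z
  · intro x y z hx hy hz
    have := dart_not_pattern hF.dart a x z y w
    have := h.adj_WU w x hw hx; have := h.adj_WU w y hw hy; have := h.adj_WU w z hw hz
    have := h.not_adj_AU a x ha hx; have := h.not_adj_AU a y ha hy
    have := h.not_adj_AU a z ha hz
    grind [G.adj_comm]
  · intro x y z hx hy hz
    have := G65_not_pattern hF.G65 v z x y a w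
    have := h.adj_WU w x hw hx; have := h.adj_WU w y hw hy; have := h.adj_WU w z hw hz
    have := h.not_adj_AU a x ha hx; have := h.not_adj_AU a y ha hy
    have := h.not_adj_AU a z ha hz
    have := h.not_adj_QU v x hv hx; have := h.not_adj_QU v y hv hy
    have := h.not_adj_QU v z hv hz
    grind [G.adj_comm]

theorem isCompleteMultipartiteOneLarge [Fintype V] (h : TwinLayers G Q A W U)
    (hW : ∀ w, ¬ W w) : IsCompleteMultipartiteOneLarge G := by
  obtain ⟨u, v, hu, hv, huv⟩ := h.exists_twins
  have hc : ∀ x, Q x ∨ A x := by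
    intro x
    rcases h.cover x with hx | hx | hx | hx
    · exact Or.inl hx
    · exact Or.inr hx
    · exact absurd hx (hW x)
    · obtain ⟨w, hw, -⟩ := h.exists_adj_U x hx
      exact absurd hw (hW w)
  by_cases hA : ∃ a, A a
  · refine isCompleteMultipartiteOneLarge_of_independent A hA fun x y => ?_
    have := h.adj_QQ x y; have := h.adj_QA x y; have := h.adj_QA y x; have := h.not_adj_AA x y
    have := hc x; have := hc y
    grind [G.adj_comm, Adj.ne]
  -- Here the graph is complete, and any single vertex serves as the distinguished part.
  · refine isCompleteMultipartiteOneLarge_of_independent (· = v) ⟨v, rfl⟩ fun x y => ?_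
    have := h.adj_QQ x y; have := hc x; have := hc y
    grind [Adj.ne]

/-- `A` is split according to the presence of a neighbor in `W`. -/
theorem exists_isPathBlocks_five (h : TwinLayers G Q A W U)
    (hW : ∀ x y, W x → W y → x ≠ y → G.Adj x y) (hU : ∀ x y, U x → U y → ¬ G.Adj x y) :
    ∃ c : V → Fin 5, IsPathBlocks G (fun i => i = 1 ∨ i = 3) c := by
  refine exists_isPathBlocks ![fun x => A x ∧ ∀ w, W w → ¬ G.Adj x w, Q,
    fun x => A x ∧ ∃ w, W w ∧ G.Adj x w, W, U] ?_ ?_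
  · intro x
    by_cases hx : ∃ w, W w ∧ G.Adj x w
    · rcases h.cover x with hc | hc | hc | hc
      exacts [⟨1, hc⟩, ⟨2, hc, hx⟩, ⟨3, hc⟩, ⟨4, hc⟩]
    · push Not at hx
      rcases h.cover x with hc | hc | hc | hc
      exacts [⟨1, hc⟩, ⟨0, hc, hx⟩, ⟨3, hc⟩, ⟨4, hc⟩]
  · have h1 := h.adj_QQ
    have h2 := h.adj_QA
    have h3 := h.not_adj_AA
    have h4 := h.not_adj_QW
    have h5 := h.not_adj_QU
    have h6 := h.not_adj_AU
    have h7 := h.adj_WU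
    have h8 : ∀ a w, A a → (∃ w, W w ∧ G.Adj a w) → W w → G.Adj a w := by
      rintro a x ha ⟨w, hw, haw⟩ hx
      obtain ⟨b, hb, hbx⟩ := h.exists_adj_W x hx
      exact h.adj_AW b a x w hb ha hx hw hbx haw
    have h9 : ∀ x, ¬ G.Adj x x := fun x => G.irrefl
    intro i j hij x y
    fin_cases i <;> fin_cases j <;> simp [pathGraph_adj] at hij ⊢ <;> grind [G.adj_comm]

theorem exists_isPathBlocks_four (h : TwinLayers G Q A W U)
    (hA : ∀ a, A a → ∃ w, W w ∧ G.Adj a w) (hW : ∀ x y, W x → W y → ¬ G.Adj x y)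
    (hU : ∀ x y, U x → U y → x ≠ y → G.Adj x y) :
    ∃ c : V → Fin 4, IsPathBlocks G (fun i => i = 0 ∨ i = 3) c := by
  refine exists_isPathBlocks ![Q, A, W, U] ?_ ?_
  · intro x
    rcases h.cover x with hc | hc | hc | hc
    exacts [⟨0, hc⟩, ⟨1, hc⟩, ⟨2, hc⟩, ⟨3, hc⟩]
  · have h1 := h.adj_QQ
    have h2 := h.adj_QA
    have h3 := h.not_adj_AA
    have h4 := h.not_adj_QW
    have h5 := h.not_adj_QU
    have h6 := h.not_adj_AU
    have h7 := h.adj_WU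
    have h8 : ∀ a w, A a → W w → G.Adj a w := by
      intro a x ha hx
      obtain ⟨w, hw, haw⟩ := hA a ha
      obtain ⟨b, hb, hbx⟩ := h.exists_adj_W x hx
      exact h.adj_AW b a x w hb ha hx hw hbx haw
    have h9 : ∀ x, ¬ G.Adj x x := fun x => G.irrefl
    intro i j hij x y
    fin_cases i <;> fin_cases j <;> simp [pathGraph_adj] at hij ⊢ <;> grind [G.adj_comm]

/-- Four blocks occur when `W` has two nonadjacent vertices or `U` has an edge: then all of `A` sees
`W`, `W` is independent and `U` is a clique. Otherwise `W` is a clique and `U` is independent, and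
`A` may have vertices without neighbors in `W`, which form a fifth block. -/
theorem exists_isPathBlocks (hF : CoreFree G) (h67 : ¬ G67 ⊴ G) (h : TwinLayers G Q A W U)
    (hne : ∃ w, W w) : (∃ c : V → Fin 5, IsPathBlocks G (fun i => i = 1 ∨ i = 3) c) ∨
      ∃ c : V → Fin 4, IsPathBlocks G (fun i => i = 0 ∨ i = 3) c := by
  obtain ⟨w, hw⟩ := hne
  obtain ⟨u, v, hu, hv, huv⟩ := h.exists_twins
  obtain ⟨a, ha, haw⟩ := h.exists_adj_W w hw
  have haW : ∀ x, W x → G.Adj a x := fun x hx => by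
    obtain ⟨b, hb, hbx⟩ := h.exists_adj_W x hx
    exact h.adj_AW b a x w hb ha hx hw hbx haw
  have hua := h.adj_QA u a hu ha
  have hva := h.adj_QA v a hv ha
  by_cases hW : ∃ x y, W x ∧ W y ∧ x ≠ y ∧ ¬ G.Adj x y
  · obtain ⟨x, y, hx, hy, hxy, hna⟩ := hW
    refine Or.inr (h.exists_isPathBlocks_four ?_ ?_ ?_)
    · intro b hb
      by_contra! hc
      have := G69_not_pattern hF.G69 x y b u v a
      have := h.adj_QA u b hu hb; have := h.adj_QA v b hv hb; have := h.not_adj_AA a b ha hb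
      have := hc x hx; have := hc y hy; have := haW x hx; have := haW y hy
      have := h.not_adj_QW u x hu hx; have := h.not_adj_QW u y hu hy
      have := h.not_adj_QW v x hv hx; have := h.not_adj_QW v y hv hy
      grind [G.adj_comm]
    · exact fun p q hp hq hpq => hna (h.adj_W_of_edge hF hp hq hpq x y hx hy hxy)
    · intro p q hp hq hpq
      by_contra hc
      have := G615_not_pattern hF.G615 u v p q x y a
      have := haW x hx; have := haW y hy
      have := h.adj_WU x p hx hp; have := h.adj_WU x q hx hq
      have := h.adj_WU y p hy hp; have := h.adj_WU y q hy hq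
      have := h.not_adj_QW u x hu hx; have := h.not_adj_QW u y hu hy
      have := h.not_adj_QW v x hv hx; have := h.not_adj_QW v y hv hy
      have := h.not_adj_QU u p hu hp; have := h.not_adj_QU u q hu hq
      have := h.not_adj_QU v p hv hp; have := h.not_adj_QU v q hv hq
      have := h.not_adj_AU a p ha hp; have := h.not_adj_AU a q ha hq
      grind [G.adj_comm]
  push Not at hW
  by_cases hU : ∃ x y, U x ∧ U y ∧ G.Adj x y
  · obtain ⟨x, y, hx, hy, hxy⟩ := hU
    have hax := h.not_adj_AU a x ha hx
    have hay := h.not_adj_AU a y ha hy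
    have hwx := h.adj_WU w x hw hx
    have hwy := h.adj_WU w y hw hy
    refine Or.inr (h.exists_isPathBlocks_four ?_ ?_ (h.adj_U_of_edge hF hx hy hxy))
    · intro b hb
      by_contra! hc
      have := G67_not_pattern h67 b x y a v w
      have := h.adj_QA v b hv hb; have := h.not_adj_AA a b ha hb
      have := hc w hw; have := h.not_adj_QW v w hv hw
      have := h.not_adj_QU v x hv hx; have := h.not_adj_QU v y hv hy
      have := h.not_adj_AU b x hb hx; have := h.not_adj_AU b y hb hy
      grind [G.adj_comm]
    -- An edge of `W` and an edge of `U` together with `a` would form a full house, so `W` is a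
    -- single vertex here.
    · intro p q hp hq hpq
      have := fullHouse_not_pattern hF.fullHouse a x y p q
      have := haW p hp; have := haW q hq
      have := h.adj_WU p x hp hx; have := h.adj_WU p y hp hy
      have := h.adj_WU q x hq hx; have := h.adj_WU q y hq hy
      grind [G.adj_comm]
  · push Not at hU
    exact Or.inl (h.exists_isPathBlocks_five hW hU)

end TwinLayers

/-! ### From forbidden subgraphs to the list, and the theorem. -/

section Main

variable {V : Type*} [Fintype V] {G : SimpleGraph V}

theorem isListed_of_isFamilyFree (hG : G.Connected) (h : IsFamilyFree (family ∪ oddHoles7) G) :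
    IsListed G := by
  have hF : CoreFree G := by
    constructor
    exacts [h ⟨5, bull⟩ (by simp [family]), h ⟨5, dart⟩ (by simp [family]),
      h ⟨5, house⟩ (by simp [family]), h ⟨5, gem⟩ (by simp [family]),
      h ⟨5, fullHouse⟩ (by simp [family]), h ⟨6, G65⟩ (by simp [family]),
      h ⟨6, fivePan⟩ (by simp [family]), h ⟨6, G68⟩ (by simp [family]),
      h ⟨6, G69⟩ (by simp [family]), h ⟨6, G610⟩ (by simp [family]),
      h ⟨6, G612⟩ (by simp [family]), h ⟨6, coTwinC5⟩ (by simp [family]),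
      h ⟨6, G614⟩ (by simp [family]), h ⟨7, G615⟩ (by simp [family])]
  have h67 : ¬ G67 ⊴ G := h ⟨6, G67⟩ (by simp [family])
  have hct : ¬ coTwinHouse ⊴ G := h ⟨6, coTwinHouse⟩ (by simp [family])
  by_cases hb : G.IsBipartite
  · exact Or.inr (Or.inl hb)
  obtain ⟨k, hodd, hk, f⟩ := exists_odd_cycleGraph_isIndContained hb
  rcases le_or_gt 7 k with h7 | h7
  · exact absurd f (h ⟨k, cycleGraph k⟩ (Or.inr ⟨k, h7, hodd, rfl⟩))
  have hk' : k = 3 ∨ k = 5 := by obtain ⟨m, rfl⟩ := hodd; omega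
  rcases hk' with rfl | rfl
  swap
  · exact Or.inl (nonempty_iso_cycleGraph_five hG hF f)
  obtain ⟨f⟩ := f
  have key : (cycleGraph 3).Adj 0 1 ∧ (cycleGraph 3).Adj 0 2 ∧ (cycleGraph 3).Adj 1 2 := by decide
  by_cases hW : ∃ v a b p q, IsFourWheel G v a b p q
  · obtain ⟨v, a, b, p, q, hW⟩ := hW
    exact Or.inr (Or.inr (Or.inl (hW.isCompleteTripartite hF hG)))
  push Not at hW
  obtain ⟨u, v, huv, ht⟩ := exists_isTwin_of_triangle hF hW (f.map_adj_iff.2 key.1)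
    (f.map_adj_iff.2 key.2.1) (f.map_adj_iff.2 key.2.2)
  obtain ⟨Q, A, W, U, hL⟩ := ht.exists_twinLayers hF h67 hct hG huv
  have hpos : 0 < Fintype.card V := Fintype.card_pos_iff.2 ⟨u⟩
  set N := Fintype.card V
  by_cases hne : ∃ w, W w
  · rcases hL.exists_isPathBlocks hF h67 hne with ⟨c, hc⟩ | ⟨c, hc⟩
    · refine Or.inr (Or.inr (Or.inr (Or.inr (Or.inl ⟨N, N, N, N, N, hc.isIndContained ?_ ?_ ?_⟩))))
      all_goals intro i; fin_cases i <;> simp <;> omega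
    · refine Or.inr (Or.inr (Or.inr (Or.inr (Or.inr ⟨N, N, N, N, hc.isIndContained ?_ ?_ ?_⟩))))
      all_goals intro i; fin_cases i <;> simp <;> omega
  · push Not at hne
    exact Or.inr (Or.inr (Or.inr (Or.inl (hL.isCompleteMultipartiteOneLarge hne))))

end Main

theorem mainTheorem1 {V : Type*} [Fintype V] [DecidableEq V] (G : SimpleGraph V)
    (hG : G.Connected) :
    (MemLambda ℤ 2 G ↔
      (Nonempty (G ≃g SimpleGraph.cycleGraph 5) ∨
        G.IsBipartite ∨
        IsCompleteTripartite G ∨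
        IsCompleteMultipartiteOneLarge G ∨
        (∃ m₁ n₁ m₂ n₂ m₃ : ℕ,
          G.IsIndContained
            (pathBlowup ![-(m₁ : ℤ), (n₁ : ℤ), -(m₂ : ℤ), (n₂ : ℤ), -(m₃ : ℤ)])) ∨
        (∃ n₁ m₁ m₂ n₂ : ℕ,
          G.IsIndContained (pathBlowup ![(n₁ : ℤ), -(m₁ : ℤ), -(m₂ : ℤ), (n₂ : ℤ)])))) ∧
    (MemLambda ℤ 2 G ↔
      IsFamilyFree (ForbiddenGraph.family ∪ ForbiddenGraph.oddHoles7) G) := by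
  have h1 : MemLambda ℤ 2 G → IsFamilyFree (family ∪ oddHoles7) G := fun h => by
    obtain ⟨K, _, M, hM⟩ :=
      exists_isRankTwoCompletion ((memLambda_iff_distanceIdeal_ne_top hG 2).1 h)
    exact hM.isFamilyFree hG
  have h2 : IsFamilyFree (family ∪ oddHoles7) G → IsListed G := isListed_of_isFamilyFree hG
  have h3 : IsListed G → MemLambda ℤ 2 G := fun h =>
    (memLambda_iff_distanceIdeal_ne_top hG 2).2 (h.distanceIdeal_three_ne_top hG)
  exact ⟨⟨fun h => h2 (h1 h), h3⟩, h1, fun h => h3 (h2 h)⟩
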